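/- Let $g=(g_{ij})\in C^2(\mathbb{R}^N;\mathcal S^N)$ be a field of symmetric $N\times N$ matrices such that, for some $C>0$ and all $x,w\in\mathbb{R}^N$, $\frac1C|w|^2\le (g(x)w,w)\le C|w|^2$. Put $$d_g(x,y)=\inf\Big\{\int_0^1 \tfrac12 (g(\gamma_t)\dot\gamma_t,\dot\gamma_t)^{1/2}\,dt:\ \gamma\in C^1([0,1];\mathbb{R}^N),\ \gamma_0=x,\ \gamma_1=y\Big\},\qquad e_g=d_g^2 ,$$ and assume that $\Upsilon>0$ is such that $e_g$ is $C^1$ on $\{(x,y)\in\mathbb{R}^N\times\mathbb{R}^N: d_g(x,y)<\Upsilon\}$. A modulus is a nondecreasing subadditive $\omega:[0,\infty)\to[0,\infty)$ with $\lim_{r\to0}\omega(r)=\omega(0)=0$; for $\lambda>0$ let $\theta(\omega,\lambda)=\sup_{r\ge0}\{\omega(r)-\lambda r^2/2\}$, and $\theta(\omega,\infty)=0$. Let $T>0$, let $\xi,\zeta\in C^1([0,T];\mathbb{R})$ with $\xi_0=\zeta_0=0$, and set $\Delta_T^+=\max_{s\in[0,T]}(\xi_s-\zeta_s)$, $\Delta_T^-=\max_{s\in[0,T]}(\zeta_s-\xi_s)$.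 Let $u_0,v_0:\mathbb{R}^N\to\mathbb{R}$ be bounded, with $|u_0(x)-u_0(y)|\le\omega_{u_0}(d_g(x,y))$ and $|v_0(x)-v_0(y)|\le\omega_{v_0}(d_g(x,y))$ for all $x,y$, where $\omega_{u_0},\omega_{v_0}$ are moduli. Let $u$ be a bounded upper semicontinuous, and $v$ a bounded lower semicontinuous, real function on $\mathbb{R}^N\times[0,T]$ which are, respectively, a viscosity subsolution and a viscosity supersolution of $$u_t-(g^{-1}(x)Du,Du)\,\dot\xi\le0\ \text{ in }\mathbb{R}^N\times(0,T],\qquad u(\cdot,0)\le u_0\ \text{ on }\mathbb{R}^N,$$ $$v_t-(g^{-1}(x)Dv,Dv)\,\dot\zeta\ge0\ \text{ in }\mathbb{R}^N\times(0,T],\qquad v(\cdot,0)\ge v_0\ \text{ on }\mathbb{R}^N.$$ If $$\Delta_T^++\Delta_T^-<\frac{\Upsilon^2}{2\,(\sup_{\mathbb{R}^N}|u_0|+\sup_{\mathbb{R}^N}|v_0|)}$$ (the right-hand side being $+\infty$ if $u_0=v_0=0$), then $$\sup_{\mathbb{R}^N\times[0,T]}(u-v)\ \le\ \sup_{\mathbb{R}^N}(u_0-v_0)+\theta\Big(\omega_{u_0}\wedge\omega_{v_0},\frac1{\Delta_T^+}\Big),$$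 where $\wedge$ is the pointwise minimum and $1/\Delta_T^+=\infty$ if $\Delta_T^+=0$. -/

import Mathlib

open Set Filter Topology
open scoped ENNReal

noncomputable section

/-- The quadratic form `(A w, w) = ∑ i j, A i j * w i * w j`. -/
def quadForm {N : ℕ} (A : Matrix (Fin N) (Fin N) ℝ) (w : EuclideanSpace ℝ (Fin N)) : ℝ :=
  ∑ i, ∑ j, A i j * w i * w j

/-- `g` is a `C^2` field of symmetric matrices on `ℝ^N`, uniformly positive definite and bounded:
`C⁻¹ |w|² ≤ (g(x) w, w) ≤ C |w|²` for some `C > 0`. -/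
structure IsC2Metric {N : ℕ} (g : EuclideanSpace ℝ (Fin N) → Matrix (Fin N) (Fin N) ℝ) :
    Prop where
  contDiff : ∀ i j, ContDiff ℝ 2 (fun x => g x i j)
  isSymm : ∀ x, (g x).IsSymm
  elliptic : ∃ C : ℝ, 0 < C ∧ ∀ x w : EuclideanSpace ℝ (Fin N),
    1 / C * ‖w‖ ^ 2 ≤ quadForm (g x) w ∧ quadForm (g x) w ≤ C * ‖w‖ ^ 2

/-- The quadratic Hamiltonian `H(p, x) = (g⁻¹(x) p, p)`. -/
def hamiltonian {N : ℕ} (g : EuclideanSpace ℝ (Fin N) → Matrix (Fin N) (Fin N) ℝ)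
    (p x : EuclideanSpace ℝ (Fin N)) : ℝ :=
  quadForm (g x)⁻¹ p

/-- The length `∫₀¹ ½ (g(γ) γ', γ')^{1/2} dt` of a curve on `[0, 1]` (note the factor `½`). -/
def curveLength {N : ℕ} (g : EuclideanSpace ℝ (Fin N) → Matrix (Fin N) (Fin N) ℝ)
    (γ : ℝ → EuclideanSpace ℝ (Fin N)) : ℝ :=
  ∫ t in (0 : ℝ)..1, 1 / 2 * Real.sqrt (quadForm (g (γ t)) (derivWithin γ (Icc 0 1) t))

/-- The distance `d_g(x, y)`: infimum of the lengths of the `C^1` curves on `[0, 1]`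
from `x` to `y`. -/
def metricDist {N : ℕ} (g : EuclideanSpace ℝ (Fin N) → Matrix (Fin N) (Fin N) ℝ)
    (x y : EuclideanSpace ℝ (Fin N)) : ℝ :=
  sInf {L : ℝ | ∃ γ : ℝ → EuclideanSpace ℝ (Fin N),
    ContDiffOn ℝ 1 γ (Icc 0 1) ∧ γ 0 = x ∧ γ 1 = y ∧ L = curveLength g γ}

/-- The energy `e_g = d_g²`. -/
def metricEnergy {N : ℕ} (g : EuclideanSpace ℝ (Fin N) → Matrix (Fin N) (Fin N) ℝ)
    (x y : EuclideanSpace ℝ (Fin N)) : ℝ :=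
  metricDist g x y ^ 2

/-- A modulus: a nondecreasing subadditive function `ω : [0, ∞) → [0, ∞)` with
`ω(r) → 0 = ω(0)` as `r → 0`. Only the values on `[0, ∞)` matter. -/
structure IsModulus (ω : ℝ → ℝ) : Prop where
  nonneg : ∀ r, 0 ≤ r → 0 ≤ ω r
  mono : MonotoneOn ω (Ici 0)
  subadd : ∀ r s, 0 ≤ r → 0 ≤ s → ω (r + s) ≤ ω r + ω s
  map_zero : ω 0 = 0
  tendsto_zero : Tendsto ω (𝓝[≥] 0) (𝓝 0)

/-- `ω` is a modulus of continuity of `f` with respect to `d_g`. -/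
def HasModulus {N : ℕ} (g : EuclideanSpace ℝ (Fin N) → Matrix (Fin N) (Fin N) ℝ)
    (f : EuclideanSpace ℝ (Fin N) → ℝ) (ω : ℝ → ℝ) : Prop :=
  IsModulus ω ∧ ∀ x y, |f x - f y| ≤ ω (metricDist g x y)

/-- The supremum norm over `ℝ^N` (used for bounded functions). -/
def supNorm {N : ℕ} (f : EuclideanSpace ℝ (Fin N) → ℝ) : ℝ := ⨆ x, |f x|

/-- `θ(ω, lam) = sup_{r ≥ 0} (ω(r) - lam r² / 2)`, for `lam ∈ [0, ∞]`, with values in the extended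
reals. For `lam = ∞` the convention `∞ * 0 = 0` gives the value `ω(0)`. -/
def theta (ω : ℝ → ℝ) (lam : ℝ≥0∞) : EReal :=
  ⨆ r ∈ Ici (0 : ℝ), ((ω r : ℝ) : EReal) - ((lam * ENNReal.ofReal (r ^ 2 / 2) : ℝ≥0∞) : EReal)

/-- `Δ_T^+ = max_{s ∈ [0, T]} (ξ_s - ζ_s)`; then `Δ_T^-` is the same with `ξ`, `ζ` exchanged. -/
def pathGap (T : ℝ) (ξ ζ : ℝ → ℝ) : ℝ := sSup ((fun s => ξ s - ζ s) '' Icc 0 T)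

/-- The space-time domain `ℝ^N × [0, T]`. -/
def closedCylinder (N : ℕ) (T : ℝ) : Set (EuclideanSpace ℝ (Fin N) × ℝ) := univ ×ˢ Icc 0 T

/-- The space-time domain `ℝ^N × (0, T]`. -/
def openCylinder (N : ℕ) (T : ℝ) : Set (EuclideanSpace ℝ (Fin N) × ℝ) := univ ×ˢ Ioc 0 T

/-- `φ_t - (g⁻¹(x) Dφ, Dφ) ξ'(t)` at the point `(x, t)`, with `t ∈ [0, T]`. -/
def hjOperator {N : ℕ} (g : EuclideanSpace ℝ (Fin N) → Matrix (Fin N) (Fin N) ℝ)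
    (T : ℝ) (ξ : ℝ → ℝ) (φ : EuclideanSpace ℝ (Fin N) × ℝ → ℝ)
    (x : EuclideanSpace ℝ (Fin N)) (t : ℝ) : ℝ :=
  deriv (fun s => φ (x, s)) t
    - hamiltonian g (gradient (fun y => φ (y, t)) x) x * derivWithin ξ (Icc 0 T) t

/-- Bounded upper semicontinuous viscosity subsolution on `ℝ^N × [0, T]` of
`u_t - (g⁻¹(x) Du, Du) ξ' ≤ 0` in `ℝ^N × (0, T]`, `u(·, 0) ≤ u₀` on `ℝ^N`. Test functions are
`C^1` near the point of contact, and contact is relative to `ℝ^N × (0, T]`. -/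
structure IsViscositySubsolution {N : ℕ}
    (g : EuclideanSpace ℝ (Fin N) → Matrix (Fin N) (Fin N) ℝ) (T : ℝ) (ξ : ℝ → ℝ)
    (u₀ : EuclideanSpace ℝ (Fin N) → ℝ) (u : EuclideanSpace ℝ (Fin N) × ℝ → ℝ) : Prop where
  bounded : ∃ C : ℝ, ∀ z ∈ closedCylinder N T, |u z| ≤ C
  usc : UpperSemicontinuousOn u (closedCylinder N T)
  initial : ∀ x, u (x, 0) ≤ u₀ x
  viscosity : ∀ (φ : EuclideanSpace ℝ (Fin N) × ℝ → ℝ) (x : EuclideanSpace ℝ (Fin N)) (t : ℝ),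
    t ∈ Ioc 0 T → ContDiffAt ℝ 1 φ (x, t) →
    IsLocalMaxOn (fun z => u z - φ z) (openCylinder N T) (x, t) →
    hjOperator g T ξ φ x t ≤ 0

/-- Bounded lower semicontinuous viscosity supersolution on `ℝ^N × [0, T]` of
`v_t - (g⁻¹(x) Dv, Dv) ζ' ≥ 0` in `ℝ^N × (0, T]`, `v(·, 0) ≥ v₀` on `ℝ^N`. -/
structure IsViscositySupersolution {N : ℕ}
    (g : EuclideanSpace ℝ (Fin N) → Matrix (Fin N) (Fin N) ℝ) (T : ℝ) (ζ : ℝ → ℝ)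
    (v₀ : EuclideanSpace ℝ (Fin N) → ℝ) (v : EuclideanSpace ℝ (Fin N) × ℝ → ℝ) : Prop where
  bounded : ∃ C : ℝ, ∀ z ∈ closedCylinder N T, |v z| ≤ C
  lsc : LowerSemicontinuousOn v (closedCylinder N T)
  initial : ∀ x, v₀ x ≤ v (x, 0)
  viscosity : ∀ (φ : EuclideanSpace ℝ (Fin N) × ℝ → ℝ) (x : EuclideanSpace ℝ (Fin N)) (t : ℝ),
    t ∈ Ioc 0 T → ContDiffAt ℝ 1 φ (x, t) →
    IsLocalMinOn (fun z => v z - φ z) (openCylinder N T) (x, t) →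
    0 ≤ hjOperator g T ζ φ x t

end

/-!
The estimate is proved by doubling the variables with the energy `e = d_g²` as penalization. The
function `e(x, y) / (c - ξ_t + ζ_t)` solves both Hamilton–Jacobi equations exactly, in `x` and in
`y`, because `e` satisfies the eikonal equation `(g⁻¹ De, De) = e` in each variable
(`hamiltonian_gradient_metricEnergy`). Hence at a maximum of
`u(x, t) - v(y, t) - e(x, y) / (c - ξ_t + ζ_t)` the two viscosity inequalities cancel, so that the
maximum is reached at time `0`, where it is at most the supremum of
`u₀(x) - v₀(y) - e(x, y) / c`. Any `c > Δ⁺` makes the denominator positive. With `Δ⁺ < c ≤ 2 Δ⁺`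
the initial supremum is at most `sup (u₀ - v₀) + θ(ω, 1 / Δ⁺)`; when `Δ⁺ = 0`, a small `c` makes
it as close to `sup (u₀ - v₀)` as desired.

The energy is only assumed `C¹` where `d_g < Υ`. Since a subsolution stays below the supremum of its
initial values (`IsViscositySubsolution.le_of_initial_le`), at a point where the doubled functional
exceeds a bound `B ≥ sup (u₀ - v₀)` one has `e ≤ 2 (sup |u₀| + sup |v₀|) (c + Δ⁻)`, which is less
than `Υ²` for `c` close to `Δ⁺`: this is the smallness condition on `Δ⁺ + Δ⁻`.

The eikonal equation has an elementary proof that uses no geodesics. The upper bound is the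
triangle inequality applied to short segments. For the lower bound, an almost minimizing curve from
`x` to `y` is followed until it leaves a small ball about `x`: up to small errors the distance to
`y` has then decreased by the length of that arc (`metricDist_le_sqrt_hamiltonian`).

In the doubling itself (`add_le_of_doubling`), `-v` is regarded as a subsolution driven by `-ζ`, so
that both functions play the same role, the two functions are taken at different times `t`, `s` with
a penalization `k (t - s)²`, and a term `δ (1 + |x|²)^{1/2} + η t` gives compactness and strictness.
-/

noncomputable section

/-! ### Quadratic forms and their duals -/

section Algebra

variable {N : ℕ} {A : Matrix (Fin N) (Fin N) ℝ}

lemma quadForm_eq_dotProduct (A : Matrix (Fin N) (Fin N) ℝ) (w : EuclideanSpace ℝ (Fin N)) :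
    quadForm A w = w.ofLp ⬝ᵥ A.mulVec w.ofLp := by
  simp only [quadForm, dotProduct, Matrix.mulVec, Finset.mul_sum]
  refine Finset.sum_congr rfl fun i _ => Finset.sum_congr rfl fun j _ => by ring

lemma inner_eq_dotProduct_ofLp (x y : EuclideanSpace ℝ (Fin N)) :
    inner ℝ x y = x.ofLp ⬝ᵥ y.ofLp := by
  rw [EuclideanSpace.inner_eq_star_dotProduct, star_trivial, dotProduct_comm]

lemma quadForm_smul (A : Matrix (Fin N) (Fin N) ℝ) (c : ℝ) (w : EuclideanSpace ℝ (Fin N)) :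
    quadForm A (c • w) = c ^ 2 * quadForm A w := by
  simp only [quadForm_eq_dotProduct, WithLp.ofLp_smul, Matrix.mulVec_smul, smul_dotProduct,
    dotProduct_smul, smul_eq_mul]
  ring

lemma quadForm_zero_right (A : Matrix (Fin N) (Fin N) ℝ) : quadForm A 0 = 0 := by
  simp [quadForm]

lemma quadForm_neg (A : Matrix (Fin N) (Fin N) ℝ) (w : EuclideanSpace ℝ (Fin N)) :
    quadForm A (-w) = quadForm A w := by
  simp [quadForm]

lemma quadForm_add (hA : A.IsSymm) (v w : EuclideanSpace ℝ (Fin N)) :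
    quadForm A (v + w) =
      quadForm A v + 2 * (w.ofLp ⬝ᵥ A.mulVec v.ofLp) + quadForm A w := by
  have h : v.ofLp ⬝ᵥ A.mulVec w.ofLp = w.ofLp ⬝ᵥ A.mulVec v.ofLp := by
    rw [Matrix.dotProduct_mulVec, ← Matrix.mulVec_transpose, hA.eq, dotProduct_comm]
  simp only [quadForm_eq_dotProduct, WithLp.ofLp_add, Matrix.mulVec_add, add_dotProduct,
    dotProduct_add, h]
  ring

/-- The vector `A⁻¹ p`: the direction that realizes equality in the duality between the forms
of `A` and of `A⁻¹`. -/
def dualVec (A : Matrix (Fin N) (Fin N) ℝ) (p : EuclideanSpace ℝ (Fin N)) :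
    EuclideanSpace ℝ (Fin N) :=
  WithLp.toLp 2 (A⁻¹.mulVec p.ofLp)

lemma inner_dualVec (A : Matrix (Fin N) (Fin N) ℝ) (p q : EuclideanSpace ℝ (Fin N)) :
    inner ℝ q (dualVec A p) = q.ofLp ⬝ᵥ A⁻¹.mulVec p.ofLp :=
  inner_eq_dotProduct_ofLp _ _

lemma inner_self_dualVec (A : Matrix (Fin N) (Fin N) ℝ) (p : EuclideanSpace ℝ (Fin N)) :
    inner ℝ p (dualVec A p) = quadForm A⁻¹ p := by
  rw [inner_dualVec, quadForm_eq_dotProduct]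

lemma isUnit_det_of_quadForm_pos (hpos : ∀ w, w ≠ 0 → 0 < quadForm A w) : IsUnit A.det := by
  rw [isUnit_iff_ne_zero]
  intro h
  obtain ⟨w, hw, hAw⟩ := Matrix.exists_mulVec_eq_zero_iff.2 h
  have := hpos (WithLp.toLp 2 w) (by simpa using hw)
  rw [quadForm_eq_dotProduct] at this
  simp [hAw] at this

lemma mulVec_dualVec (hdet : IsUnit A.det) (p : EuclideanSpace ℝ (Fin N)) :
    A.mulVec (dualVec A p).ofLp = p.ofLp := by
  simp [dualVec, Matrix.mulVec_mulVec, Matrix.mul_nonsing_inv A hdet]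

lemma quadForm_dualVec (hdet : IsUnit A.det) (p : EuclideanSpace ℝ (Fin N)) :
    quadForm A (dualVec A p) = quadForm A⁻¹ p := by
  rw [quadForm_eq_dotProduct, mulVec_dualVec hdet, dotProduct_comm, ← inner_eq_dotProduct_ofLp,
    inner_self_dualVec]

/-- Cauchy–Schwarz inequality for the form of `A`, in dual form. -/
lemma inner_sq_le_quadForm_inv_mul (hA : A.IsSymm) (hpos : ∀ w, w ≠ 0 → 0 < quadForm A w)
    (p v : EuclideanSpace ℝ (Fin N)) :
    inner ℝ p v ^ 2 ≤ quadForm A⁻¹ p * quadForm A v := by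
  have hdet := isUnit_det_of_quadForm_pos hpos
  have hnn : ∀ w, 0 ≤ quadForm A w := fun w => by
    rcases eq_or_ne w 0 with rfl | h
    · rw [quadForm_zero_right]
    · exact (hpos w h).le
  have key : ∀ t : ℝ, 0 ≤ quadForm A v * (t * t) + 2 * inner ℝ p v * t + quadForm A⁻¹ p := by
    intro t
    have h := hnn (dualVec A p + t • v)
    rw [quadForm_add hA, quadForm_smul, quadForm_dualVec hdet, mulVec_dualVec hdet,
      ← inner_eq_dotProduct_ofLp, inner_smul_left, real_inner_comm] at h
    simp only [conj_trivial] at h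
    linarith
  have := discrim_le_zero key
  rw [discrim] at this
  nlinarith

end Algebra

/-! ### Uniformly elliptic metrics -/

namespace IsC2Metric

variable {N : ℕ} {g : EuclideanSpace ℝ (Fin N) → Matrix (Fin N) (Fin N) ℝ}

lemma quadForm_pos (hg : IsC2Metric g) (x w : EuclideanSpace ℝ (Fin N)) (hw : w ≠ 0) :
    0 < quadForm (g x) w := by
  obtain ⟨C, hC, h⟩ := hg.elliptic
  have : 0 < ‖w‖ := norm_pos_iff.2 hw
  exact lt_of_lt_of_le (by positivity) (h x w).1

lemma quadForm_nonneg (hg : IsC2Metric g) (x w : EuclideanSpace ℝ (Fin N)) :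
    0 ≤ quadForm (g x) w := by
  obtain ⟨C, hC, h⟩ := hg.elliptic
  exact le_trans (by positivity) (h x w).1

lemma hamiltonian_nonneg (hg : IsC2Metric g) (p x : EuclideanSpace ℝ (Fin N)) :
    0 ≤ hamiltonian g p x := by
  rw [hamiltonian, ← quadForm_dualVec (isUnit_det_of_quadForm_pos (hg.quadForm_pos x))]
  exact hg.quadForm_nonneg _ _

lemma inner_sq_le (hg : IsC2Metric g) (p x v : EuclideanSpace ℝ (Fin N)) :
    inner ℝ p v ^ 2 ≤ hamiltonian g p x * quadForm (g x) v :=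
  inner_sq_le_quadForm_inv_mul (hg.isSymm x) (hg.quadForm_pos x) p v

lemma abs_inner_le (hg : IsC2Metric g) (p x v : EuclideanSpace ℝ (Fin N)) :
    |inner ℝ p v| ≤ √(hamiltonian g p x) * √(quadForm (g x) v) := by
  rw [← Real.sqrt_mul (hg.hamiltonian_nonneg p x)]
  exact Real.abs_le_sqrt (hg.inner_sq_le p x v)

/-- There is a direction in which a covector `p` reaches its dual norm. -/
lemma exists_inner_eq (hg : IsC2Metric g) (p x : EuclideanSpace ℝ (Fin N)) :
    ∃ v, inner ℝ p v = hamiltonian g p x ∧ quadForm (g x) v = hamiltonian g p x :=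
  ⟨dualVec (g x) p, inner_self_dualVec _ _,
    quadForm_dualVec (isUnit_det_of_quadForm_pos (hg.quadForm_pos x)) _⟩

lemma hamiltonian_smul (c : ℝ) (p x : EuclideanSpace ℝ (Fin N)) :
    hamiltonian g (c • p) x = c ^ 2 * hamiltonian g p x := quadForm_smul _ _ _

lemma hamiltonian_neg (p x : EuclideanSpace ℝ (Fin N)) :
    hamiltonian g (-p) x = hamiltonian g p x := quadForm_neg _ _

/-- A perturbation of the covector by `q` changes the Hamiltonian by a term of first order in the
dual norm of `q`. -/
lemma abs_hamiltonian_add_sub_le (hg : IsC2Metric g) (p q x : EuclideanSpace ℝ (Fin N)) :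
    |hamiltonian g (p + q) x - hamiltonian g p x| ≤
      2 * (√(hamiltonian g q x) * √(hamiltonian g p x)) + hamiltonian g q x := by
  have hdet := isUnit_det_of_quadForm_pos (hg.quadForm_pos x)
  have hsymm : ((g x)⁻¹).IsSymm := by
    rw [Matrix.IsSymm, Matrix.transpose_nonsing_inv, (hg.isSymm x).eq]
  have h1 : hamiltonian g (p + q) x - hamiltonian g p x =
      2 * inner ℝ q (dualVec (g x) p) + hamiltonian g q x := by
    rw [hamiltonian, quadForm_add hsymm, inner_dualVec, hamiltonian, hamiltonian]
    ring
  have h2 := hg.abs_inner_le q x (dualVec (g x) p)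
  rw [quadForm_dualVec hdet, ← hamiltonian] at h2
  rw [h1]
  have h3 := hg.hamiltonian_nonneg q x
  rw [abs_le] at h2 ⊢
  constructor <;> linarith [h2.1, h2.2]

lemma exists_hamiltonian_le (hg : IsC2Metric g) :
    ∃ C, 0 < C ∧ ∀ p x, hamiltonian g p x ≤ C * ‖p‖ ^ 2 := by
  obtain ⟨C, hC, h⟩ := hg.elliptic
  refine ⟨C, hC, fun p x => ?_⟩
  obtain ⟨v, hv1, hv2⟩ := hg.exists_inner_eq p x
  have h1 := real_inner_le_norm p v
  have h2 := (h x v).1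
  rw [hv2] at h2
  rw [hv1] at h1
  have h3 := hg.hamiltonian_nonneg p x
  have h4 : ‖v‖ ^ 2 ≤ C * hamiltonian g p x := by
    rw [one_div, inv_mul_le_iff₀ hC] at h2
    exact h2
  have h5 : hamiltonian g p x ^ 2 ≤ ‖p‖ ^ 2 * (C * hamiltonian g p x) :=
    calc hamiltonian g p x ^ 2 ≤ (‖p‖ * ‖v‖) ^ 2 := pow_le_pow_left₀ h3 h1 2
      _ = ‖p‖ ^ 2 * ‖v‖ ^ 2 := by ring
      _ ≤ _ := by gcongr
  rcases h3.eq_or_lt with h0 | h0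
  · rw [← h0]; positivity
  · refine le_of_mul_le_mul_right (a := hamiltonian g p x) ?_ h0
    linarith

lemma continuous_quadForm (hg : IsC2Metric g) :
    Continuous fun p : EuclideanSpace ℝ (Fin N) × EuclideanSpace ℝ (Fin N) =>
      quadForm (g p.1) p.2 := by
  unfold quadForm
  refine continuous_finsetSum _ fun i _ => continuous_finsetSum _ fun j _ => ?_
  have := (hg.contDiff i j).continuous
  fun_prop

lemma exists_norm_le (hg : IsC2Metric g) :
    ∃ m, 0 < m ∧ ∀ x w, m * ‖w‖ ≤ √(quadForm (g x) w) := by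
  obtain ⟨C, hC, h⟩ := hg.elliptic
  refine ⟨√(1 / C), by positivity, fun x w => ?_⟩
  refine Real.le_sqrt_of_sq_le ?_
  rw [mul_pow, Real.sq_sqrt (by positivity)]
  exact (h x w).1

lemma exists_le_norm (hg : IsC2Metric g) :
    ∃ M, 0 < M ∧ ∀ x w, √(quadForm (g x) w) ≤ M * ‖w‖ := by
  obtain ⟨C, hC, h⟩ := hg.elliptic
  refine ⟨√C, by positivity, fun x w => ?_⟩
  refine Real.sqrt_le_iff.2 ⟨by positivity, ?_⟩
  rw [mul_pow, Real.sq_sqrt (by positivity)]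
  exact (h x w).2

/-- The norms defined by `g` at nearby points are uniformly equivalent, with a constant that tends
to `1`. -/
lemma eventually_sqrt_quadForm_le (hg : IsC2Metric g) (x : EuclideanSpace ℝ (Fin N)) {κ : ℝ}
    (hκ : 0 < κ) : ∀ᶠ z in 𝓝 x, ∀ w,
      √(quadForm (g z) w) ≤ (1 + κ) * √(quadForm (g x) w) ∧
      √(quadForm (g x) w) ≤ (1 + κ) * √(quadForm (g z) w) := by
  obtain ⟨C, hC, hell⟩ := hg.elliptic
  have hsum : Tendsto (fun z => ∑ i, ∑ j, |g z i j - g x i j|) (𝓝 x) (𝓝 0) := by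
    have hc : Continuous fun z => ∑ i, ∑ j, |g z i j - g x i j| := by
      refine continuous_finsetSum _ fun i _ => continuous_finsetSum _ fun j _ => ?_
      have := (hg.contDiff i j).continuous
      fun_prop
    simpa using hc.tendsto x
  have hε : 0 < κ / C := by positivity
  filter_upwards [hsum.eventually (gt_mem_nhds hε)] with z hz w
  have hdiff : |quadForm (g z) w - quadForm (g x) w| ≤ κ / C * ‖w‖ ^ 2 := by
    have h1 : quadForm (g z) w - quadForm (g x) w =
        ∑ i, ∑ j, (g z i j - g x i j) * w i * w j := by
      simp only [quadForm, ← Finset.sum_sub_distrib]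
      refine Finset.sum_congr rfl fun i _ => Finset.sum_congr rfl fun j _ => by ring
    rw [h1]
    calc |∑ i, ∑ j, (g z i j - g x i j) * w i * w j|
        ≤ ∑ i, ∑ j, |(g z i j - g x i j) * w i * w j| :=
          (Finset.abs_sum_le_sum_abs _ _).trans
            (Finset.sum_le_sum fun i _ => Finset.abs_sum_le_sum_abs _ _)
      _ ≤ ∑ i, ∑ j, |g z i j - g x i j| * ‖w‖ ^ 2 := by
          refine Finset.sum_le_sum fun i _ => Finset.sum_le_sum fun j _ => ?_
          have hi := PiLp.norm_apply_le w i
          have hj := PiLp.norm_apply_le w j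
          rw [Real.norm_eq_abs] at hi hj
          rw [abs_mul, abs_mul, mul_assoc, sq]
          gcongr
      _ = (∑ i, ∑ j, |g z i j - g x i j|) * ‖w‖ ^ 2 := by
          simp only [Finset.sum_mul]
      _ ≤ _ := by gcongr
  have hcomp : ∀ y, κ / C * ‖w‖ ^ 2 ≤ κ * quadForm (g y) w := fun y => by
    have := mul_le_mul_of_nonneg_left (hell y w).1 hκ.le
    calc κ / C * ‖w‖ ^ 2 = κ * (1 / C * ‖w‖ ^ 2) := by ring
      _ ≤ _ := this
  have hsq : ∀ a b : ℝ, 0 ≤ b → a ≤ b + κ * b → √a ≤ (1 + κ) * √b := fun a b hb hab => by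
    refine Real.sqrt_le_iff.2 ⟨by positivity, ?_⟩
    rw [mul_pow, Real.sq_sqrt hb]
    nlinarith [mul_nonneg hκ.le hb, mul_nonneg (sq_nonneg κ) hb]
  rw [abs_le] at hdiff
  exact ⟨hsq _ _ (hg.quadForm_nonneg x w) (by linarith [hcomp x]),
    hsq _ _ (hg.quadForm_nonneg z w) (by linarith [hcomp z])⟩

end IsC2Metric

/-! ### Extension of curves -/

/-- A `C¹` function on a compact interval is the restriction of a `C¹` function on the line. -/
lemma ContDiffOn.exists_contDiff_eqOn {F : Type*} [NormedAddCommGroup F] [NormedSpace ℝ F]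
    [CompleteSpace F] {f : ℝ → F} {a b : ℝ} (hab : a < b) (hf : ContDiffOn ℝ 1 f (Icc a b)) :
    ∃ F : ℝ → F, ContDiff ℝ 1 F ∧ EqOn F f (Icc a b) := by
  have hc : ContinuousOn (derivWithin f (Icc a b)) (Icc a b) :=
    hf.continuousOn_derivWithin (uniqueDiffOn_Icc hab) le_rfl
  set G : ℝ → F := IccExtend hab.le ((Icc a b).domRestrict (derivWithin f (Icc a b))) with hG
  have hGc : Continuous G := (continuousOn_iff_continuous_domRestrict.1 hc).Icc_extend'
  have hGeq : ∀ t ∈ Icc a b, G t = derivWithin f (Icc a b) t := fun t ht => by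
    rw [hG, IccExtend_of_mem _ _ ht, domRestrict_apply]
  set H : ℝ → F := fun t => f a + ∫ s in a..t, G s with hH
  have hd : ∀ t, HasDerivAt H (G t) t := fun t =>
    (intervalIntegral.integral_hasDerivAt_right (hGc.intervalIntegrable _ _)
      hGc.stronglyMeasurable.stronglyMeasurableAtFilter hGc.continuousAt).const_add _
  refine ⟨H, ?_, ?_⟩
  · refine contDiff_one_iff_deriv.2 ⟨fun t => (hd t).differentiableAt, ?_⟩
    rwa [funext fun t => (hd t).deriv]
  · refine eq_of_derivWithin_eq (fun t _ => (hd t).differentiableAt.differentiableWithinAt)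
      (hf.differentiableOn (by simp)) ?_ (by simp [hH])
    intro t ht
    rw [(hd t).hasDerivWithinAt.derivWithin ((uniqueDiffOn_Icc hab) t ⟨ht.1, ht.2.le⟩),
      hGeq t ⟨ht.1, ht.2.le⟩]

lemma derivWithin_Icc_eq_deriv_of_eqOn {F : Type*} [NormedAddCommGroup F] [NormedSpace ℝ F]
    {f H : ℝ → F} {a b t : ℝ} (hab : a < b) (hH : ContDiff ℝ 1 H) (h : EqOn H f (Icc a b))
    (ht : t ∈ Icc a b) : derivWithin f (Icc a b) t = deriv H t := by
  rw [← derivWithin_congr h (h ht)]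
  exact (hH.differentiable (by simp) t).derivWithin (uniqueDiffOn_Icc hab t ht)

/-! ### The distance of a metric -/

/-- The speed `½ (g(γ) γ', γ')^{1/2}` of a curve defined on the whole line. -/
def curveSpeed {N : ℕ} (g : EuclideanSpace ℝ (Fin N) → Matrix (Fin N) (Fin N) ℝ)
    (γ : ℝ → EuclideanSpace ℝ (Fin N)) (t : ℝ) : ℝ :=
  1 / 2 * √(quadForm (g (γ t)) (deriv γ t))

section Distance

variable {N : ℕ} {g : EuclideanSpace ℝ (Fin N) → Matrix (Fin N) (Fin N) ℝ}
  {γ : ℝ → EuclideanSpace ℝ (Fin N)}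

lemma IsC2Metric.continuous_curveSpeed (hg : IsC2Metric g) (hγ : ContDiff ℝ 1 γ) :
    Continuous (curveSpeed g γ) := by
  have h := hg.continuous_quadForm.comp (hγ.continuous.prodMk (hγ.continuous_deriv le_rfl))
  exact continuous_const.mul h.sqrt

lemma curveSpeed_comp {σ : ℝ → ℝ} {s t : ℝ} (hγ : ContDiff ℝ 1 γ) (hσ : HasDerivAt σ s t) :
    curveSpeed g (fun t => γ (σ t)) t = |s| * curveSpeed g γ (σ t) := by
  have h : HasDerivAt (fun t => γ (σ t)) (s • deriv γ (σ t)) t :=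
    (hγ.differentiable (by simp) (σ t)).hasDerivAt.scomp t hσ
  rw [curveSpeed, h.deriv, quadForm_smul, Real.sqrt_mul (sq_nonneg _), Real.sqrt_sq_eq_abs,
    curveSpeed]
  ring

lemma curveSpeed_congr {γ' : ℝ → EuclideanSpace ℝ (Fin N)} {t : ℝ} (h : γ =ᶠ[𝓝 t] γ') :
    curveSpeed g γ t = curveSpeed g γ' t := by
  rw [curveSpeed, curveSpeed, h.deriv_eq, h.eq_of_nhds]

lemma curveLength_eq_integral_curveSpeed {γ' : ℝ → EuclideanSpace ℝ (Fin N)}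
    (hγ : ContDiff ℝ 1 γ) (h : EqOn γ γ' (Icc 0 1)) :
    curveLength g γ' = ∫ t in (0 : ℝ)..1, curveSpeed g γ t := by
  refine intervalIntegral.integral_congr fun t ht => ?_
  rw [uIcc_of_le zero_le_one] at ht
  simp only [curveSpeed]
  rw [h ht, derivWithin_Icc_eq_deriv_of_eqOn zero_lt_one hγ h ht]

lemma metricDist_nonneg (x y : EuclideanSpace ℝ (Fin N)) : 0 ≤ metricDist g x y := by
  refine Real.sInf_nonneg ?_
  rintro _ ⟨γ, -, -, -, rfl⟩
  exact intervalIntegral.integral_nonneg zero_le_one fun t _ => by positivity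

lemma metricEnergy_nonneg (x y : EuclideanSpace ℝ (Fin N)) : 0 ≤ metricEnergy g x y :=
  sq_nonneg _

lemma metricDist_le_curveLength (hγ : ContDiffOn ℝ 1 γ (Icc 0 1)) :
    metricDist g (γ 0) (γ 1) ≤ curveLength g γ := by
  refine csInf_le ⟨0, ?_⟩ ⟨γ, hγ, rfl, rfl, rfl⟩
  rintro _ ⟨γ, -, -, -, rfl⟩
  exact intervalIntegral.integral_nonneg zero_le_one fun t _ => by positivity

/-- The distance is at most the length of any `C¹` arc, whatever its interval of definition. -/
lemma metricDist_le_integral (hγ : ContDiff ℝ 1 γ) {a b : ℝ} (hab : a ≤ b) :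
    metricDist g (γ a) (γ b) ≤ ∫ t in a..b, curveSpeed g γ t := by
  have hσ : ∀ t : ℝ, HasDerivAt (fun t => a + (b - a) * t) (b - a) t := fun t => by
    simpa using ((hasDerivAt_id t).const_mul (b - a)).const_add a
  have hΓ : ContDiff ℝ 1 fun t => γ (a + (b - a) * t) := hγ.comp (by fun_prop)
  have h := metricDist_le_curveLength (g := g) hΓ.contDiffOn
  rw [curveLength_eq_integral_curveSpeed hΓ fun _ _ => rfl] at h
  simp only [curveSpeed_comp hγ (hσ _), abs_of_nonneg (sub_nonneg.2 hab),
    intervalIntegral.integral_const_mul, intervalIntegral.mul_integral_comp_add_mul] at h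
  simpa using h

/-- Almost minimizing curves, defined on the whole line. -/
lemma exists_curve_integral_lt (x y : EuclideanSpace ℝ (Fin N)) {κ : ℝ} (hκ : 0 < κ) :
    ∃ γ : ℝ → EuclideanSpace ℝ (Fin N), ContDiff ℝ 1 γ ∧ γ 0 = x ∧ γ 1 = y ∧
      ∫ t in (0 : ℝ)..1, curveSpeed g γ t < metricDist g x y + κ := by
  have hne : {L : ℝ | ∃ γ : ℝ → EuclideanSpace ℝ (Fin N),
      ContDiffOn ℝ 1 γ (Icc 0 1) ∧ γ 0 = x ∧ γ 1 = y ∧ L = curveLength g γ}.Nonempty :=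
    ⟨_, fun t => x + t • (y - x), by fun_prop, by simp, by simp, rfl⟩
  obtain ⟨_, ⟨γ, hγ, h0, h1, rfl⟩, hlt⟩ := Real.lt_sInf_add_pos hne hκ
  obtain ⟨Γ, hΓ, heq⟩ := hγ.exists_contDiff_eqOn zero_lt_one
  refine ⟨Γ, hΓ, ?_, ?_, ?_⟩
  · rw [heq (by simp), h0]
  · rw [heq (by simp), h1]
  · rwa [← curveLength_eq_integral_curveSpeed hΓ heq]

lemma metricDist_comm (x y : EuclideanSpace ℝ (Fin N)) :
    metricDist g x y = metricDist g y x := by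
  suffices H : ∀ x y, metricDist g x y ≤ metricDist g y x from le_antisymm (H x y) (H y x)
  intro x y
  refine le_of_forall_pos_le_add fun κ hκ => ?_
  obtain ⟨γ, hγ, rfl, rfl, hlt⟩ := exists_curve_integral_lt (g := g) y x hκ
  have h := metricDist_le_integral (g := g) (hγ.comp contDiff_neg) (a := -1) (b := 0) (by norm_num)
  simp only [Function.comp_def, neg_neg, neg_zero, curveSpeed_comp hγ (hasDerivAt_neg _), abs_neg,
    abs_one, one_mul] at h
  rw [intervalIntegral.integral_comp_neg] at h
  simp only [neg_neg, neg_zero] at h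
  exact h.trans hlt.le

/-- The triangle inequality. Two arcs are joined into a `C¹` arc after a change of parameter that
makes them stop at the junction. -/
lemma metricDist_triangle (hg : IsC2Metric g) (x y z : EuclideanSpace ℝ (Fin N)) :
    metricDist g x z ≤ metricDist g x y + metricDist g y z := by
  refine le_of_forall_pos_le_add fun κ hκ => ?_
  obtain ⟨γ₁, hγ₁, rfl, h1, hlt₁⟩ := exists_curve_integral_lt (g := g) x y (half_pos hκ)
  obtain ⟨γ₂, hγ₂, h2, rfl, hlt₂⟩ := exists_curve_integral_lt (g := g) y z (half_pos hκ)
  set S := Real.smoothTransition with hS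
  have hSc : ContDiff ℝ 1 S := Real.smoothTransition.contDiff
  have hSd : ∀ t, HasDerivAt S (deriv S t) t := fun t =>
    (hSc.differentiable (by simp) t).hasDerivAt
  have hS' : ∀ t, 0 ≤ deriv S t := fun t => Real.smoothTransition.monotone.deriv_nonneg
  have hlen : ∀ γ : ℝ → EuclideanSpace ℝ (Fin N), ContDiff ℝ 1 γ →
      ∫ t in (0 : ℝ)..1, curveSpeed g (fun t => γ (S t)) t =
        ∫ t in (0 : ℝ)..1, curveSpeed g γ t := fun γ hγ => by
    have h := intervalIntegral.integral_comp_mul_deriv (a := 0) (b := 1) (fun t _ => hSd t)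
      (hSc.continuous_deriv le_rfl).continuousOn (hg.continuous_curveSpeed hγ)
    rw [hS, Real.smoothTransition.zero, Real.smoothTransition.one, ← hS] at h
    rw [← h]
    refine intervalIntegral.integral_congr fun t _ => ?_
    simp only [curveSpeed_comp hγ (hSd t), abs_of_nonneg (hS' t), Function.comp_apply]
    ring
  set Γ : ℝ → EuclideanSpace ℝ (Fin N) := fun t => γ₁ (S t) + (γ₂ (S (t - 1)) - y) with hΓ
  have hΓc : ContDiff ℝ 1 Γ := (hγ₁.comp hSc).add
    ((hγ₂.comp (hSc.comp (contDiff_id.sub contDiff_const))).sub contDiff_const)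
  have hΓ0 : Γ 0 = γ₁ 0 := by
    simp only [hΓ, hS, Real.smoothTransition.zero]
    rw [Real.smoothTransition.zero_of_nonpos (by norm_num), h2, sub_self, add_zero]
  have hΓ2 : Γ 2 = γ₂ 1 := by
    simp only [hΓ, hS]
    rw [Real.smoothTransition.one_of_one_le (by norm_num),
      Real.smoothTransition.one_of_one_le (by norm_num), h1]
    abel
  have hint₁ : ∫ t in (0 : ℝ)..1, curveSpeed g Γ t = ∫ t in (0 : ℝ)..1, curveSpeed g γ₁ t := by
    rw [← hlen γ₁ hγ₁]
    refine intervalIntegral.integral_congr_Ioo_of_le zero_le_one fun t ht => ?_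
    refine curveSpeed_congr ?_
    filter_upwards [Iio_mem_nhds ht.2] with s hs
    simp only [hΓ, hS]
    rw [Real.smoothTransition.zero_of_nonpos (sub_nonpos.2 (le_of_lt hs)), h2, sub_self, add_zero]
  have hint₂ : ∫ t in (1 : ℝ)..2, curveSpeed g Γ t = ∫ t in (0 : ℝ)..1, curveSpeed g γ₂ t := by
    rw [← hlen γ₂ hγ₂]
    have h3 : ∫ t in (1 : ℝ)..2, curveSpeed g (fun t => γ₂ (S t)) (t - 1) =
        ∫ t in (0 : ℝ)..1, curveSpeed g (fun t => γ₂ (S t)) t := by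
      rw [intervalIntegral.integral_comp_sub_right]
      norm_num
    rw [← h3]
    refine intervalIntegral.integral_congr_Ioo_of_le (by norm_num) fun t ht => ?_
    have h4 := curveSpeed_comp (g := g) (γ := fun t => γ₂ (S t)) (hγ₂.comp hSc)
      ((hasDerivAt_id t).sub_const 1)
    simp only [abs_one, one_mul, id] at h4
    rw [← h4]
    refine curveSpeed_congr ?_
    filter_upwards [Ioi_mem_nhds ht.1] with s hs
    simp only [hΓ, hS]
    rw [Real.smoothTransition.one_of_one_le (le_of_lt hs), h1]
    abel
  have hint : ∀ a b, IntervalIntegrable (curveSpeed g Γ) MeasureTheory.volume a b :=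
    fun a b => (hg.continuous_curveSpeed hΓc).intervalIntegrable a b
  have h := metricDist_le_integral (g := g) hΓc (zero_le_two (α := ℝ))
  rw [hΓ0, hΓ2, ← intervalIntegral.integral_add_adjacent_intervals (hint 0 1) (hint 1 2), hint₁,
    hint₂] at h
  linarith

lemma metricDist_segment_le (x v : EuclideanSpace ℝ (Fin N)) :
    metricDist g x (x + v) ≤ ∫ t in (0 : ℝ)..1, 1 / 2 * √(quadForm (g (x + t • v)) v) := by
  have hc : ContDiff ℝ 1 fun t : ℝ => x + t • v := by fun_prop
  have hd : ∀ t : ℝ, HasDerivAt (fun t : ℝ => x + t • v) v t := fun t => by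
    simpa using ((hasDerivAt_id t).smul_const v).const_add x
  simpa [curveSpeed, (hd _).deriv] using metricDist_le_integral (g := g) hc zero_le_one

lemma exists_metricDist_le_norm (hg : IsC2Metric g) :
    ∃ M, 0 < M ∧ ∀ x y, metricDist g x y ≤ M * ‖x - y‖ := by
  obtain ⟨M, hM, h⟩ := hg.exists_le_norm
  refine ⟨M, hM, fun x y => ?_⟩
  have hc : Continuous fun t : ℝ => 1 / 2 * √(quadForm (g (x + t • (y - x))) (y - x)) :=
    continuous_const.mul (hg.continuous_quadForm.comp
      ((by fun_prop : Continuous fun t : ℝ => x + t • (y - x)).prodMk continuous_const)).sqrt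
  have h1 := metricDist_segment_le (g := g) x (y - x)
  rw [add_sub_cancel] at h1
  refine h1.trans ?_
  calc _ ≤ ∫ t in (0 : ℝ)..1, M * ‖x - y‖ := by
        refine intervalIntegral.integral_mono_on zero_le_one (hc.intervalIntegrable _ _)
          intervalIntegrable_const fun t _ => ?_
        have := h (x + t • (y - x)) (y - x)
        rw [norm_sub_rev] at this
        have h0 := Real.sqrt_nonneg (quadForm (g (x + t • (y - x))) (y - x))
        linarith
    _ = _ := by simp

/-- The length of an arc controls the Euclidean distance of its endpoints. -/
lemma exists_norm_le_integral (hg : IsC2Metric g) :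
    ∃ m, 0 < m ∧ ∀ γ : ℝ → EuclideanSpace ℝ (Fin N), ContDiff ℝ 1 γ → ∀ a b, a ≤ b →
      m * ‖γ a - γ b‖ ≤ ∫ t in a..b, curveSpeed g γ t := by
  obtain ⟨m, hm, h⟩ := hg.exists_norm_le
  refine ⟨m / 2, by positivity, fun γ hγ a b hab => ?_⟩
  have hcd := hγ.continuous_deriv le_rfl
  have h1 : ∫ t in a..b, deriv γ t = γ b - γ a :=
    intervalIntegral.integral_deriv_eq_sub (fun t _ => hγ.differentiable (by simp) t)
      (hcd.intervalIntegrable _ _)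
  rw [norm_sub_rev, ← h1]
  calc m / 2 * ‖∫ t in a..b, deriv γ t‖ ≤ m / 2 * ∫ t in a..b, ‖deriv γ t‖ := by
        gcongr
        exact intervalIntegral.norm_integral_le_integral_norm hab
    _ = ∫ t in a..b, m / 2 * ‖deriv γ t‖ := by
        rw [intervalIntegral.integral_const_mul]
    _ ≤ _ := by
        refine intervalIntegral.integral_mono_on hab
          ((continuous_const.mul hcd.norm).intervalIntegrable _ _)
          ((hg.continuous_curveSpeed hγ).intervalIntegrable _ _) fun t _ => ?_
        have := h (γ t) (deriv γ t)
        rw [curveSpeed]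
        linarith

lemma exists_norm_le_metricDist (hg : IsC2Metric g) :
    ∃ m, 0 < m ∧ ∀ x y, m * ‖x - y‖ ≤ metricDist g x y := by
  obtain ⟨m, hm, h⟩ := exists_norm_le_integral hg
  refine ⟨m, hm, fun x y => le_of_forall_pos_le_add fun κ hκ => ?_⟩
  obtain ⟨γ, hγ, rfl, rfl, hlt⟩ := exists_curve_integral_lt (g := g) x y hκ
  exact (h γ hγ 0 1 zero_le_one).trans hlt.le

lemma metricDist_self (hg : IsC2Metric g) (x : EuclideanSpace ℝ (Fin N)) :
    metricDist g x x = 0 := by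
  obtain ⟨M, -, h⟩ := exists_metricDist_le_norm hg
  exact le_antisymm (by simpa using h x x) (metricDist_nonneg _ _)

lemma continuous_metricDist (hg : IsC2Metric g) :
    Continuous fun p : EuclideanSpace ℝ (Fin N) × EuclideanSpace ℝ (Fin N) =>
      metricDist g p.1 p.2 := by
  obtain ⟨M, hM, h⟩ := exists_metricDist_le_norm hg
  refine LipschitzWith.continuous (K := ⟨2 * M, by positivity⟩)
    (LipschitzWith.of_le_add_mul _ fun p q => ?_)
  have h1 := metricDist_triangle hg p.1 q.1 p.2
  have h2 := metricDist_triangle hg q.1 q.2 p.2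
  have h3 := h p.1 q.1
  have h4 := h q.2 p.2
  rw [← dist_eq_norm] at h3 h4
  rw [dist_comm] at h4
  have h5 : dist p.1 q.1 ≤ dist p q := le_max_left _ _
  have h6 : dist p.2 q.2 ≤ dist p q := le_max_right _ _
  have h7 := mul_le_mul_of_nonneg_left h5 hM.le
  have h8 := mul_le_mul_of_nonneg_left h6 hM.le
  change _ ≤ metricDist g q.1 q.2 + 2 * M * dist p q
  linarith

lemma continuous_metricEnergy (hg : IsC2Metric g) :
    Continuous fun p : EuclideanSpace ℝ (Fin N) × EuclideanSpace ℝ (Fin N) =>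
      metricEnergy g p.1 p.2 :=
  (continuous_metricDist hg).pow 2

lemma isOpen_metricDist_lt (hg : IsC2Metric g) (r : ℝ) :
    IsOpen {p : EuclideanSpace ℝ (Fin N) × EuclideanSpace ℝ (Fin N) | metricDist g p.1 p.2 < r} :=
  isOpen_lt (continuous_metricDist hg) continuous_const

end Distance

/-! ### The eikonal equation of the energy -/

section Eikonal

variable {N : ℕ} {g : EuclideanSpace ℝ (Fin N) → Matrix (Fin N) (Fin N) ℝ}

lemma le_of_forall_pos_le_add_mul {a b c : ℝ} (h : ∀ κ > 0, a ≤ b + κ * c) : a ≤ b := by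
  have h1 : Tendsto (fun κ : ℝ => b + κ * c) (𝓝[>] 0) (𝓝 b) := by
    have : Tendsto (fun κ : ℝ => b + κ * c) (𝓝 0) (𝓝 (b + 0 * c)) :=
      Continuous.tendsto (by fun_prop) 0
    rw [zero_mul, add_zero] at this
    exact this.mono_left nhdsWithin_le_nhds
  exact ge_of_tendsto h1 (by filter_upwards [self_mem_nhdsWithin] with κ hκ using h κ hκ)

/-- Derivatives of the energy are bounded by the distance: moving along a short segment changes
the distance by at most the length of the segment. -/
lemma inner_gradient_metricEnergy_le (hg : IsC2Metric g) {x y p : EuclideanSpace ℝ (Fin N)}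
    (h : HasGradientAt (fun x => metricEnergy g x y) p x) (v : EuclideanSpace ℝ (Fin N)) :
    inner ℝ p v ≤ metricDist g x y * √(quadForm (g x) v) := by
  set d := metricDist g x y with hd
  set q := √(quadForm (g x) v) with hq
  have hd0 : 0 ≤ d := metricDist_nonneg _ _
  have hq0 : 0 ≤ q := Real.sqrt_nonneg _
  refine le_of_forall_pos_le_add_mul (c := d * q) fun κ hκ => ?_
  have hline : HasDerivAt (fun t : ℝ => metricEnergy g (x + t • v) y) (inner ℝ p v) 0 := by
    have h1 : HasDerivAt (fun t : ℝ => x + t • v) v 0 := by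
      simpa using ((hasDerivAt_id (0 : ℝ)).smul_const v).const_add x
    have h2 := h.hasFDerivAt
    rw [show x = x + (0 : ℝ) • v by simp] at h2
    exact h2.comp_hasDerivAt 0 h1
  have hslope := hline.tendsto_slope_zero_right
  obtain ⟨ρ, hρ, hball⟩ := Metric.eventually_nhds_iff.1 (hg.eventually_sqrt_quadForm_le x hκ)
  have hlim : Tendsto (fun t : ℝ => d * q + κ * (d * q) + t * ((1 + κ) / 2 * q) ^ 2) (𝓝[>] 0)
      (𝓝 (d * q + κ * (d * q))) := by
    have : Tendsto (fun t : ℝ => d * q + κ * (d * q) + t * ((1 + κ) / 2 * q) ^ 2) (𝓝 0)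
        (𝓝 (d * q + κ * (d * q) + 0 * ((1 + κ) / 2 * q) ^ 2)) :=
      Continuous.tendsto (by fun_prop) 0
    rw [zero_mul, add_zero] at this
    exact this.mono_left nhdsWithin_le_nhds
  refine le_of_tendsto_of_tendsto hslope hlim ?_
  have hsmall : ∀ᶠ t : ℝ in 𝓝[>] 0, t * ‖v‖ < ρ := by
    have : Tendsto (fun t : ℝ => t * ‖v‖) (𝓝 0) (𝓝 (0 * ‖v‖)) :=
      Continuous.tendsto (by fun_prop) 0
    rw [zero_mul] at this
    exact (this.mono_left nhdsWithin_le_nhds).eventually (gt_mem_nhds hρ)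
  filter_upwards [hsmall, self_mem_nhdsWithin] with t ht ht0
  have ht0 : 0 < t := ht0
  have hseg : metricDist g x (x + t • v) ≤ t * ((1 + κ) / 2 * q) := by
    have hc : Continuous fun s : ℝ => 1 / 2 * √(quadForm (g (x + s • t • v)) (t • v)) :=
      continuous_const.mul (hg.continuous_quadForm.comp
        ((by fun_prop : Continuous fun s : ℝ => x + s • t • v).prodMk continuous_const)).sqrt
    refine (metricDist_segment_le x (t • v)).trans ?_
    calc _ ≤ ∫ s in (0 : ℝ)..1, t * ((1 + κ) / 2 * q) := by
          refine intervalIntegral.integral_mono_on zero_le_one (hc.intervalIntegrable _ _)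
            intervalIntegrable_const fun s hs => ?_
          have h1 : dist (x + s • t • v) x < ρ := by
            rw [dist_eq_norm, add_sub_cancel_left, norm_smul, norm_smul, Real.norm_eq_abs,
              Real.norm_eq_abs, abs_of_nonneg hs.1, abs_of_pos ht0]
            have : 0 ≤ t * ‖v‖ := by positivity
            nlinarith [hs.2]
          have h2 := (hball h1 (t • v)).1
          rw [quadForm_smul (g x), Real.sqrt_mul (sq_nonneg t), Real.sqrt_sq ht0.le, ← hq] at h2
          linarith
      _ = _ := by simp
  have htri := metricDist_triangle hg (x + t • v) x y
  rw [metricDist_comm (x + t • v) x, ← hd] at htri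
  have h0 : 0 ≤ metricDist g (x + t • v) y := metricDist_nonneg _ _
  simp only [zero_add, zero_smul, add_zero, smul_eq_mul, metricEnergy, ← hd]
  rw [inv_mul_le_iff₀ ht0]
  have h1 : metricDist g (x + t • v) y ^ 2 ≤ (t * ((1 + κ) / 2 * q) + d) ^ 2 :=
    pow_le_pow_left₀ h0 (by linarith) 2
  calc _ ≤ (t * ((1 + κ) / 2 * q) + d) ^ 2 - d ^ 2 := by linarith
    _ = _ := by ring

/-- An almost minimizing curve from `x` to `y` is followed until it leaves the ball of radius `r`
about `x`; here `ℓ` is the length of that initial arc and `x'` its endpoint. -/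
lemma exists_initial_arc (hg : IsC2Metric g) {x y : EuclideanSpace ℝ (Fin N)}
    (p : EuclideanSpace ℝ (Fin N)) {κ m r : ℝ} (hr : 0 < r) (hrxy : r ≤ ‖y - x‖)
    (hm : ∀ γ : ℝ → EuclideanSpace ℝ (Fin N), ContDiff ℝ 1 γ → ∀ a b, a ≤ b →
      m * ‖γ a - γ b‖ ≤ ∫ t in a..b, curveSpeed g γ t)
    (hball : ∀ z, ‖z - x‖ ≤ r → ∀ w, √(quadForm (g x) w) ≤ (1 + κ) * √(quadForm (g z) w)) :
    ∃ x' : EuclideanSpace ℝ (Fin N), ∃ ℓ : ℝ, ‖x' - x‖ = r ∧ m * r ≤ ℓ ∧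
      ℓ + metricDist g x' y ≤ metricDist g x y + r ^ 2 ∧
      -(2 * (1 + κ) * √(hamiltonian g p x) * ℓ) ≤ inner ℝ p (x' - x) := by
  obtain ⟨γ, hγ, h0, h1, hlt⟩ := exists_curve_integral_lt (g := g) x y (pow_pos hr 2)
  have hfc : Continuous fun t => ‖γ t - x‖ := (hγ.continuous.sub continuous_const).norm
  have hcross : ∀ t, 0 ≤ t → r ≤ ‖γ t - x‖ → ∃ s ∈ Icc 0 t, ‖γ s - x‖ = r := fun t ht hrt =>
    intermediate_value_Icc ht hfc.continuousOn ⟨by simpa [h0] using hr.le, hrt⟩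
  obtain ⟨s, hs, hsr⟩ := hcross 1 zero_le_one (by rwa [h1])
  have hcomp : IsCompact (Icc (0 : ℝ) 1 ∩ {t | ‖γ t - x‖ = r}) :=
    isCompact_Icc.inter_right (isClosed_eq hfc continuous_const)
  obtain ⟨τ, ⟨hτ, hτr⟩, hmin⟩ := hcomp.exists_isLeast ⟨s, hs, hsr⟩
  have hin : ∀ t ∈ Icc 0 τ, ‖γ t - x‖ ≤ r := fun t ht => by
    by_contra! hlt
    obtain ⟨s, hs, hsr⟩ := hcross t ht.1 hlt.le
    have := hmin ⟨⟨hs.1, hs.2.trans (ht.2.trans hτ.2)⟩, hsr⟩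
    have hst : s = t := le_antisymm hs.2 (ht.2.trans this)
    rw [← hst, hsr] at hlt
    exact lt_irrefl _ hlt
  have hint : ∀ a b, IntervalIntegrable (curveSpeed g γ) MeasureTheory.volume a b :=
    fun a b => (hg.continuous_curveSpeed hγ).intervalIntegrable a b
  have hcd := hγ.continuous_deriv le_rfl
  refine ⟨γ τ, ∫ t in (0 : ℝ)..τ, curveSpeed g γ t, hτr, ?_, ?_, ?_⟩
  · have := hm γ hγ 0 τ hτ.1
    rw [h0, norm_sub_rev] at this
    rwa [← (hτr : ‖γ τ - x‖ = r)]
  · have h2 := metricDist_le_integral (g := g) hγ hτ.2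
    rw [h1] at h2
    have h3 := intervalIntegral.integral_add_adjacent_intervals (hint 0 τ) (hint τ 1)
    linarith
  · have h2 : ∫ t in (0 : ℝ)..τ, inner ℝ p (deriv γ t) = inner ℝ p (γ τ - x) := by
      have h3 := intervalIntegral.integral_deriv_eq_sub (a := 0) (b := τ)
        (fun t _ => hγ.differentiable (by simp) t) (hcd.intervalIntegrable _ _)
      rw [h0] at h3
      rw [← h3]
      exact (innerSL ℝ p).intervalIntegral_comp_comm (hcd.intervalIntegrable _ _)
    rw [← h2, ← intervalIntegral.integral_const_mul, ← intervalIntegral.integral_neg]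
    refine intervalIntegral.integral_mono_on hτ.1
      ((continuous_const.mul (hg.continuous_curveSpeed hγ)).neg.intervalIntegrable _ _)
      ((continuous_const.inner hcd).intervalIntegrable _ _) fun t ht => ?_
    have h4 := (abs_le.1 (hg.abs_inner_le p x (deriv γ t))).1
    have h5 := mul_le_mul_of_nonneg_left (hball (γ t) (hin t ht) (deriv γ t))
      (Real.sqrt_nonneg (hamiltonian g p x))
    rw [curveSpeed]
    linarith

/-- The lower bound in the eikonal equation: along an almost minimizing curve the distance decreases
at the largest possible rate. -/
lemma metricDist_le_sqrt_hamiltonian (hg : IsC2Metric g) {x y p : EuclideanSpace ℝ (Fin N)}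
    (h : HasGradientAt (fun x => metricEnergy g x y) p x) :
    metricDist g x y ≤ √(hamiltonian g p x) := by
  set d := metricDist g x y with hd
  rcases (metricDist_nonneg x y : 0 ≤ d).eq_or_lt with hd0 | hd0
  · rw [hd, ← hd0]; exact Real.sqrt_nonneg _
  have hxy : 0 < ‖y - x‖ := by
    rw [norm_pos_iff, sub_ne_zero]
    rintro rfl
    exact hd0.ne' (metricDist_self hg _)
  obtain ⟨m, hm0, hm⟩ := exists_norm_le_integral hg
  obtain ⟨M, hM0, hM⟩ := exists_metricDist_le_norm hg
  set q := √(hamiltonian g p x) with hq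
  have hq0 : 0 ≤ q := Real.sqrt_nonneg _
  -- dividing the increment of `e` by the arc length `ℓ ≥ m r` and letting `r → 0` gives this bound,
  -- where `κ` measures the oscillation of `g` and the error in the differentiability of `e` at `x`
  suffices H : ∀ κ > 0, 2 * d ≤ 2 * q + κ * (2 * q + 1 / m) by
    linarith [le_of_forall_pos_le_add_mul H]
  intro κ hκ
  obtain ⟨ρ, hρ, hball⟩ := Metric.eventually_nhds_iff.1 (hg.eventually_sqrt_quadForm_le x hκ)
  have hdiff := h.hasFDerivAt.isLittleO.bound hκ
  obtain ⟨ρ', hρ', hball'⟩ := Metric.eventually_nhds_iff.1 hdiff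
  have hlim : Tendsto (fun r : ℝ => (1 - r / m) * (2 * d - M * r)) (𝓝[>] 0) (𝓝 (2 * d)) := by
    have : Tendsto (fun r : ℝ => (1 - r / m) * (2 * d - M * r)) (𝓝 0)
        (𝓝 ((1 - 0 / m) * (2 * d - M * 0))) :=
      Continuous.tendsto (by fun_prop) 0
    simp only [zero_div, sub_zero, one_mul, mul_zero] at this
    exact this.mono_left nhdsWithin_le_nhds
  refine le_of_tendsto hlim ?_
  have hev : ∀ b : ℝ, 0 < b → ∀ᶠ r : ℝ in 𝓝[>] 0, r < b := fun b hb =>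
    (eventually_lt_nhds hb).filter_mono nhdsWithin_le_nhds
  filter_upwards [self_mem_nhdsWithin, hev ρ hρ, hev ρ' hρ', hev _ hxy, hev m hm0,
    hev (2 * d / M) (by positivity)] with r hr0 hr1 hr2 hr3 hr4 hr5
  have hr0 : 0 < r := hr0
  obtain ⟨x', ℓ, hx', hmℓ, hℓ, hp⟩ := exists_initial_arc hg p hr0 hr3.le hm
    (fun z hz w => (hball (by rw [dist_eq_norm]; exact hz.trans_lt hr1) w).2)
  have hlin := hball' (y := x') (by rw [dist_eq_norm, hx']; exact hr2)
  rw [hx', Real.norm_eq_abs, abs_le, InnerProductSpace.toDual_apply_apply] at hlin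
  simp only [metricEnergy, ← hd] at hlin
  have hx'0 : 0 ≤ metricDist g x' y := metricDist_nonneg _ _
  have htri := metricDist_triangle hg x x' y
  have hMr := hM x x'
  rw [norm_sub_rev, hx'] at hMr
  have h1 : metricDist g x' y ^ 2 ≤ (d + r ^ 2 - ℓ) ^ 2 := pow_le_pow_left₀ hx'0 (by linarith) 2
  have h2 : (ℓ - r ^ 2) * (2 * d + r ^ 2 - ℓ) ≤ 2 * (1 + κ) * q * ℓ + κ * r := by
    have : d ^ 2 - (d + r ^ 2 - ℓ) ^ 2 = (ℓ - r ^ 2) * (2 * d + r ^ 2 - ℓ) := by ring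
    linarith [hlin.1]
  have hℓ0 : 0 < ℓ := lt_of_lt_of_le (by positivity) hmℓ
  have h3 : r ≤ ℓ / m := by rw [le_div_iff₀ hm0]; linarith
  have hMr2 : M * r < 2 * d := by rw [lt_div_iff₀ hM0] at hr5; linarith
  have hrm : 0 ≤ 1 - r / m := by rw [sub_nonneg, div_le_one hm0]; exact hr4.le
  have h4 : ℓ * (1 - r / m) ≤ ℓ - r ^ 2 := by
    have : r * r ≤ r * (ℓ / m) := mul_le_mul_of_nonneg_left h3 hr0.le
    have h6 : ℓ * (1 - r / m) = ℓ - r * (ℓ / m) := by ring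
    rw [h6]
    linarith
  have h5 : ℓ * ((1 - r / m) * (2 * d - M * r)) ≤ ℓ * (2 * q + κ * (2 * q + 1 / m)) :=
    calc ℓ * ((1 - r / m) * (2 * d - M * r)) = ℓ * (1 - r / m) * (2 * d - M * r) := by ring
      _ ≤ (ℓ - r ^ 2) * (2 * d + r ^ 2 - ℓ) :=
          mul_le_mul h4 (by linarith) (by linarith) ((mul_nonneg hℓ0.le hrm).trans h4)
      _ ≤ 2 * (1 + κ) * q * ℓ + κ * r := h2
      _ ≤ 2 * (1 + κ) * q * ℓ + κ * (ℓ / m) := by gcongr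
      _ = _ := by ring
  exact le_of_mul_le_mul_left h5 hℓ0

/-- **Eikonal equation.** Wherever the energy is differentiable, `(g⁻¹ De, De) = e`. -/
lemma hamiltonian_gradient_metricEnergy (hg : IsC2Metric g) {x y p : EuclideanSpace ℝ (Fin N)}
    (h : HasGradientAt (fun x => metricEnergy g x y) p x) :
    hamiltonian g p x = metricEnergy g x y := by
  have hH := hg.hamiltonian_nonneg p x
  refine le_antisymm ?_ ?_
  · obtain ⟨v, hv1, hv2⟩ := hg.exists_inner_eq p x
    have h1 := inner_gradient_metricEnergy_le hg h v
    rw [hv1, hv2] at h1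
    have h2 : √(hamiltonian g p x) ≤ metricDist g x y := by
      rcases (Real.sqrt_nonneg (hamiltonian g p x)).eq_or_lt with h0 | h0
      · rw [← h0]; exact metricDist_nonneg _ _
      · refine le_of_mul_le_mul_right ?_ h0
        rwa [Real.mul_self_sqrt hH]
    rw [metricEnergy, ← Real.sq_sqrt hH]
    exact pow_le_pow_left₀ (Real.sqrt_nonneg _) h2 2
  · rw [metricEnergy, ← Real.sq_sqrt hH]
    exact pow_le_pow_left₀ (metricDist_nonneg _ _) (metricDist_le_sqrt_hamiltonian hg h) 2

end Eikonal

/-! ### Gradients and the penalization at infinity -/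

section JapaneseBracket

variable {F : Type*} [NormedAddCommGroup F]

/-- The function `(1 + |x|²)^{1/2}`: smooth, with linear growth and gradient bounded by `1`. -/
def japaneseBracket (x : F) : ℝ := √(1 + ‖x‖ ^ 2)

lemma one_le_japaneseBracket (x : F) : 1 ≤ japaneseBracket x :=
  Real.le_sqrt_of_sq_le (by nlinarith [sq_nonneg ‖x‖])

lemma norm_le_japaneseBracket (x : F) : ‖x‖ ≤ japaneseBracket x :=
  Real.le_sqrt_of_sq_le (by linarith)

lemma contDiff_japaneseBracket [InnerProductSpace ℝ F] : ContDiff ℝ 1 (japaneseBracket : F → ℝ) :=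
  (contDiff_const.add (contDiff_norm_sq ℝ)).sqrt fun x => by positivity

lemma norm_gradient_japaneseBracket_le [InnerProductSpace ℝ F] (x : F) :
    ‖(japaneseBracket x)⁻¹ • x‖ ≤ 1 := by
  have h := one_le_japaneseBracket x
  rw [norm_smul, norm_inv, Real.norm_of_nonneg (by linarith), inv_mul_le_iff₀ (by linarith),
    mul_one]
  exact norm_le_japaneseBracket x

end JapaneseBracket

section Gradients

variable {F : Type*} [NormedAddCommGroup F] [InnerProductSpace ℝ F] [CompleteSpace F]

lemma HasGradientAt.fun_add_real {f h : F → ℝ} {p q x : F} (hf : HasGradientAt f p x)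
    (hh : HasGradientAt h q x) : HasGradientAt (fun y => f y + h y) (p + q) x := by
  rw [hasGradientAt_iff_hasFDerivAt, map_add]
  exact hf.hasFDerivAt.add hh.hasFDerivAt

lemma HasGradientAt.add_const_real {f : F → ℝ} {p x : F} (hf : HasGradientAt f p x) (c : ℝ) :
    HasGradientAt (fun y => f y + c) p x := by
  rw [hasGradientAt_iff_hasFDerivAt]
  exact hf.hasFDerivAt.add_const c

lemma HasGradientAt.const_mul_real {f : F → ℝ} {p x : F} (hf : HasGradientAt f p x) (c : ℝ) :
    HasGradientAt (fun y => c * f y) (c • p) x := by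
  rw [hasGradientAt_iff_hasFDerivAt, map_smul]
  exact hf.hasFDerivAt.const_mul c

lemma gradient_fun_neg_real (f : F → ℝ) (x : F) :
    gradient (fun y => -f y) x = -gradient f x := by
  rw [gradient, gradient, fderiv_fun_neg, map_neg]

lemma hasGradientAt_japaneseBracket (x : F) :
    HasGradientAt japaneseBracket ((japaneseBracket x)⁻¹ • x) x := by
  rw [hasGradientAt_iff_hasFDerivAt]
  have h1 : HasFDerivAt (fun y : F => 1 + ‖y‖ ^ 2) (2 • innerSL ℝ x) x :=
    (hasStrictFDerivAt_norm_sq x).hasFDerivAt.const_add 1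
  have h2 := h1.sqrt (by positivity)
  refine h2.congr_fderiv ?_
  ext v
  simp only [one_div, FunLike.coe_smul, Pi.smul_apply, smul_eq_mul,
    InnerProductSpace.toDual_apply_apply, inner_smul_left, conj_trivial, japaneseBracket, mul_inv,
    innerSL_apply_apply, two_smul, add_apply]
  ring

end Gradients

/-! ### Viscosity subsolutions -/

section Viscosity

variable {N : ℕ} {g : EuclideanSpace ℝ (Fin N) → Matrix (Fin N) (Fin N) ℝ} {T : ℝ} {ξ : ℝ → ℝ}
  {u₀ : EuclideanSpace ℝ (Fin N) → ℝ} {u : EuclideanSpace ℝ (Fin N) × ℝ → ℝ}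

lemma IsViscositySubsolution.congr_path {ξ' : ℝ → ℝ} (hu : IsViscositySubsolution g T ξ u₀ u)
    (h : EqOn ξ' ξ (Icc 0 T)) : IsViscositySubsolution g T ξ' u₀ u where
  bounded := hu.bounded
  usc := hu.usc
  initial := hu.initial
  viscosity φ x t ht hφ hmax := by
    have h1 := hu.viscosity φ x t ht hφ hmax
    rwa [hjOperator, ← derivWithin_congr h (h ⟨ht.1.le, ht.2⟩)] at h1

lemma IsViscositySupersolution.neg {ζ : ℝ → ℝ} {v₀ : EuclideanSpace ℝ (Fin N) → ℝ}
    {v : EuclideanSpace ℝ (Fin N) × ℝ → ℝ} (hv : IsViscositySupersolution g T ζ v₀ v) :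
    IsViscositySubsolution g T (fun t => -ζ t) (fun x => -v₀ x) (fun z => -v z) where
  bounded := by simpa only [abs_neg] using hv.bounded
  usc := fun z hz b hb => by
    filter_upwards [hv.lsc z hz (-b) (by simpa using neg_lt_neg hb)] with y hy
    linarith
  initial x := neg_le_neg (hv.initial x)
  viscosity φ x t ht hφ hmax := by
    have h1 := hv.viscosity (fun z => -φ z) x t ht hφ.neg (by
      filter_upwards [hmax] with z hz
      linarith)
    rw [hjOperator] at h1 ⊢
    rw [deriv.fun_neg, gradient_fun_neg_real, IsC2Metric.hamiltonian_neg] at h1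
    rw [derivWithin.fun_neg]
    linarith

/-- The subsolution inequality at a global maximum, for a driving path that is `C¹` on the line. -/
lemma IsViscositySubsolution.le_of_forall_le (hu : IsViscositySubsolution g T ξ u₀ u)
    (hξ : ContDiff ℝ 1 ξ) {φ : EuclideanSpace ℝ (Fin N) × ℝ → ℝ}
    {x p : EuclideanSpace ℝ (Fin N)} {t q : ℝ} (ht : t ∈ Ioc 0 T) (hφ : ContDiffAt ℝ 1 φ (x, t))
    (hmax : ∀ y, ∀ s ∈ Ioc 0 T, u (y, s) - φ (y, s) ≤ u (x, t) - φ (x, t))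
    (hq : HasDerivAt (fun s => φ (x, s)) q t) (hp : HasGradientAt (fun y => φ (y, t)) p x) :
    q ≤ hamiltonian g p x * deriv ξ t := by
  have h := hu.viscosity φ x t ht hφ (by
    filter_upwards [self_mem_nhdsWithin] with z hz
    exact hmax z.1 z.2 hz.2)
  rw [hjOperator, hq.deriv, hp.gradient, derivWithin_Icc_eq_deriv_of_eqOn (ht.1.trans_le ht.2) hξ
    (fun _ _ => rfl) ⟨ht.1.le, ht.2⟩] at h
  linarith

/-- An upper semicontinuous function with a compact superlevel set has a maximum. -/
lemma exists_forall_le_of_superlevel {α : Type*} [TopologicalSpace α] {f : α → ℝ} {K D : Set α}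
    {B : ℝ} {z₀ : α} (hK : IsCompact K) (hKD : K ⊆ D) (hf : UpperSemicontinuousOn f K)
    (hsup : ∀ z ∈ D, B < f z → z ∈ K) (hz₀ : z₀ ∈ D) (hBz₀ : B < f z₀) :
    ∃ z ∈ D, B < f z ∧ ∀ y ∈ D, f y ≤ f z := by
  obtain ⟨z, hz, hmax⟩ := hf.exists_isMaxOn ⟨z₀, hsup z₀ hz₀ hBz₀⟩ hK
  have hlt : B < f z := hBz₀.trans_le (hmax (hsup z₀ hz₀ hBz₀))
  refine ⟨z, hKD hz, hlt, fun y hy => ?_⟩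
  rcases lt_or_ge B (f y) with h | h
  · exact hmax (hsup y hy h)
  · exact h.trans hlt.le

lemma exists_abs_deriv_le (hξ : ContDiff ℝ 1 ξ) (T : ℝ) :
    ∃ L, 0 ≤ L ∧ ∀ t ∈ Icc 0 T, |deriv ξ t| ≤ L := by
  obtain ⟨L, hL⟩ := isCompact_Icc.exists_bound_of_continuousOn
    (hξ.continuous_deriv le_rfl).continuousOn (s := Icc 0 T)
  exact ⟨max L 0, le_max_right _ _, fun t ht => (hL t ht).trans (le_max_left _ _)⟩

/-- Subsolutions stay below the supremum of their initial values. -/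
lemma IsViscositySubsolution.le_of_initial_le (hg : IsC2Metric g) (hT : 0 < T)
    (hξ : ContDiff ℝ 1 ξ) (hu : IsViscositySubsolution g T ξ u₀ u) {S : ℝ} (hS : ∀ x, u₀ x ≤ S) :
    ∀ z ∈ closedCylinder N T, u z ≤ S := by
  intro z₀ hz₀
  by_contra! hlt
  obtain ⟨L, hL0, hL⟩ := exists_abs_deriv_le hξ T
  obtain ⟨C, hC0, hC⟩ := hg.exists_hamiltonian_le
  obtain ⟨A, hA⟩ := hu.bounded
  set η := (u z₀ - S) / (2 * T) with hη
  have hη0 : 0 < η := div_pos (by linarith) (by linarith)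
  have hηT : η * T = (u z₀ - S) / 2 := by rw [hη]; field_simp
  obtain ⟨δ, ⟨hδ1, hδ2⟩, hδ0⟩ : ∃ δ : ℝ, (δ * japaneseBracket z₀.1 < (u z₀ - S) / 2 ∧
      δ ^ 2 * C * L < η) ∧ 0 < δ := by
    have h1 : Tendsto (fun δ : ℝ => δ * japaneseBracket z₀.1) (𝓝 0)
        (𝓝 (0 * japaneseBracket z₀.1)) := Continuous.tendsto (by fun_prop) 0
    have h2 : Tendsto (fun δ : ℝ => δ ^ 2 * C * L) (𝓝 0) (𝓝 (0 ^ 2 * C * L)) :=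
      Continuous.tendsto (by fun_prop) 0
    rw [zero_mul] at h1
    norm_num at h2
    have h3 := (h1.eventually (gt_mem_nhds (half_pos (sub_pos.2 hlt)))).and
      (h2.eventually (gt_mem_nhds hη0))
    exact ((h3.filter_mono nhdsWithin_le_nhds).and
      (self_mem_nhdsWithin : ∀ᶠ δ : ℝ in 𝓝[>] 0, δ ∈ Ioi (0 : ℝ))).exists
  set φ : EuclideanSpace ℝ (Fin N) × ℝ → ℝ := fun z => δ * japaneseBracket z.1 + η * z.2 with hφ
  have hφc : ContDiff ℝ 1 φ := (contDiff_const.mul (contDiff_japaneseBracket.comp contDiff_fst)).add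
    (contDiff_const.mul contDiff_snd)
  set K : Set (EuclideanSpace ℝ (Fin N) × ℝ) :=
    Metric.closedBall 0 ((A - S) / δ) ×ˢ Icc 0 T with hK
  have hKD : K ⊆ closedCylinder N T := fun z hz => ⟨mem_univ _, hz.2⟩
  obtain ⟨z, hz, hSz, hmax⟩ := exists_forall_le_of_superlevel (f := fun z => u z - φ z)
    (B := S) (K := K) ((isCompact_closedBall _ _).prod isCompact_Icc) hKD (by
      simp only [sub_eq_add_neg]
      exact (hu.usc.mono hKD).add hφc.continuous.neg.continuousOn.upperSemicontinuousOn) (by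
      intro z hz hSz
      refine ⟨?_, hz.2⟩
      rw [mem_closedBall_zero_iff, le_div_iff₀ hδ0]
      have h1 := (abs_le.1 (hA z hz)).2
      have h2 := mul_le_mul_of_nonneg_left (norm_le_japaneseBracket z.1) hδ0.le
      have h3 := mul_nonneg hη0.le hz.2.1
      simp only [hφ] at hSz
      linarith) hz₀ (by
      have h3 := mul_le_mul_of_nonneg_left hz₀.2.2 hη0.le
      simp only [hφ]
      linarith)
  have hφ0 : 0 ≤ φ z := by
    have h1 := one_le_japaneseBracket z.1
    have h2 := mul_nonneg hη0.le hz.2.1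
    simp only [hφ]
    positivity
  have ht : z.2 ∈ Ioc 0 T := by
    refine ⟨hz.2.1.lt_of_ne fun h0 => ?_, hz.2.2⟩
    have h1 := hu.initial z.1
    rw [h0, Prod.mk.eta] at h1
    linarith [hS z.1]
  have hvisc := hu.le_of_forall_le hξ (x := z.1) (φ := φ) ht hφc.contDiffAt
    (fun y s hs => hmax (y, s) ⟨mem_univ _, hs.1.le, hs.2⟩)
    (by simpa [hφ] using ((hasDerivAt_id z.2).const_mul η).const_add (δ * japaneseBracket z.1))
    (((hasGradientAt_japaneseBracket z.1).const_mul_real δ).add_const_real (η * z.2))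
  rw [IsC2Metric.hamiltonian_smul] at hvisc
  have h1 : hamiltonian g ((japaneseBracket z.1)⁻¹ • z.1) z.1 ≤ C := by
    refine (hC _ _).trans (mul_le_of_le_one_right hC0.le ?_)
    exact pow_le_one₀ (norm_nonneg _) (norm_gradient_japaneseBracket_le _)
  have h2 := hg.hamiltonian_nonneg ((japaneseBracket z.1)⁻¹ • z.1) z.1
  have h3 : δ ^ 2 * hamiltonian g ((japaneseBracket z.1)⁻¹ • z.1) z.1 * deriv ξ z.2 ≤
      δ ^ 2 * C * L := by
    refine (le_abs_self _).trans ?_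
    rw [abs_mul, abs_of_nonneg (by positivity)]
    gcongr
    exact hL _ hz.2
  linarith

end Viscosity

/-! ### Doubling of variables with the energy as penalization -/

section Doubling

variable {N : ℕ} {g : EuclideanSpace ℝ (Fin N) → Matrix (Fin N) (Fin N) ℝ} {T : ℝ}
  {ξ χ : ℝ → ℝ} {u₀ w₀ : EuclideanSpace ℝ (Fin N) → ℝ} {u w : EuclideanSpace ℝ (Fin N) × ℝ → ℝ}

/-- The penalized functional `u(x, t) + w(y, s) - e(x, y) / (c - ξ_t - χ_t) - δ ⟨x⟩ - η t` on pairs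
`((x, t), (y, s))`. Both paths in the denominator are evaluated at the first time `t`, so that it is
positive on the whole of `[0, T] × [0, T]`. -/
def doublingFunctional (g : EuclideanSpace ℝ (Fin N) → Matrix (Fin N) (Fin N) ℝ) (ξ χ : ℝ → ℝ)
    (u w : EuclideanSpace ℝ (Fin N) × ℝ → ℝ) (c δ η : ℝ)
    (z : (EuclideanSpace ℝ (Fin N) × ℝ) × (EuclideanSpace ℝ (Fin N) × ℝ)) : ℝ :=
  u z.1 + w z.2 - metricEnergy g z.1.1 z.2.1 / (c - ξ z.1.2 - χ z.1.2) -
    δ * japaneseBracket z.1.1 - η * z.1.2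

/-- The two viscosity inequalities at an interior maximum of the doubled functional. By the eikonal
equation `e / (c - ξ - χ)` solves both equations exactly, so that only the effects of the
penalization at infinity and of the difference of the two times are left. -/
lemma le_of_doubling_max (hg : IsC2Metric g) (hξ : ContDiff ℝ 1 ξ) (hχ : ContDiff ℝ 1 χ)
    (hu : IsViscositySubsolution g T ξ u₀ u) (hw : IsViscositySubsolution g T χ w₀ w)
    {c δ η k C L Q : ℝ} {x y : EuclideanSpace ℝ (Fin N)} {t s : ℝ} (ht : t ∈ Ioc 0 T)
    (hs : s ∈ Ioc 0 T) (hδ : 0 ≤ δ) (hC0 : 0 ≤ C) (hL : |deriv ξ t| ≤ L)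
    (hC : ∀ p x, hamiltonian g p x ≤ C * ‖p‖ ^ 2) (hc : 0 < c - ξ t - χ t)
    (hQ : metricEnergy g x y / (c - ξ t - χ t) ^ 2 ≤ Q)
    (he : ContDiffAt ℝ 1 (fun p : EuclideanSpace ℝ (Fin N) × EuclideanSpace ℝ (Fin N) =>
      metricEnergy g p.1 p.2) (x, y))
    (he' : ContDiffAt ℝ 1 (fun p : EuclideanSpace ℝ (Fin N) × EuclideanSpace ℝ (Fin N) =>
      metricEnergy g p.1 p.2) (y, x))
    (hmax : ∀ z ∈ closedCylinder N T ×ˢ closedCylinder N T,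
      doublingFunctional g ξ χ u w c δ η z - k * (z.1.2 - z.2.2) ^ 2 ≤
        doublingFunctional g ξ χ u w c δ η ((x, t), (y, s)) - k * (t - s) ^ 2) :
    η ≤ (2 * (δ * √C * √Q) + δ ^ 2 * C) * L + Q * |deriv χ s - deriv χ t| := by
  set D := c - ξ t - χ t with hD
  have hex : ContDiffAt ℝ 1 (fun x' => metricEnergy g x' y) x :=
    he.comp x (contDiffAt_id.prodMk contDiffAt_const)
  have hey : ContDiffAt ℝ 1 (fun y' => metricEnergy g y' x) y :=
    he'.comp y (contDiffAt_id.prodMk contDiffAt_const)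
  have hcomm : ∀ y', metricEnergy g x y' = metricEnergy g y' x := fun y' => by
    rw [metricEnergy, metricEnergy, metricDist_comm]
  have hpx := (hex.differentiableAt (by simp)).hasGradientAt
  have hpy := (hey.differentiableAt (by simp)).hasGradientAt
  set p := gradient (fun x' => metricEnergy g x' y) x
  set p' := gradient (fun y' => metricEnergy g y' x) y
  have hHp : hamiltonian g (D⁻¹ • p) x = metricEnergy g x y / D ^ 2 := by
    rw [IsC2Metric.hamiltonian_smul, hamiltonian_gradient_metricEnergy hg hpx]
    field_simp
  have hHp' : hamiltonian g (D⁻¹ • p') y = metricEnergy g x y / D ^ 2 := by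
    rw [IsC2Metric.hamiltonian_smul, hamiltonian_gradient_metricEnergy hg hpy, hcomm]
    field_simp
  have hξt : HasDerivAt ξ (deriv ξ t) t := (hξ.differentiable (by simp) t).hasDerivAt
  have hχt : HasDerivAt χ (deriv χ t) t := (hχ.differentiable (by simp) t).hasDerivAt
  -- the inequality for `u`
  have h1 : metricEnergy g x y / D ^ 2 * (deriv ξ t + deriv χ t) + η + k * (2 * (t - s)) ≤
      hamiltonian g (D⁻¹ • p + δ • ((japaneseBracket x)⁻¹ • x)) x * deriv ξ t := by
    refine hu.le_of_forall_le hξ (φ := fun z => metricEnergy g z.1 y / (c - ξ z.2 - χ z.2) +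
      δ * japaneseBracket z.1 + η * z.2 + k * (z.2 - s) ^ 2) ht ?_ ?_ ?_ ?_
    · have hden : ContDiff ℝ 1 fun z : EuclideanSpace ℝ (Fin N) × ℝ => c - ξ z.2 - χ z.2 :=
        (contDiff_const.sub (hξ.comp contDiff_snd)).sub (hχ.comp contDiff_snd)
      have hψ : ContDiff ℝ 1 fun z : EuclideanSpace ℝ (Fin N) × ℝ => δ * japaneseBracket z.1 :=
        contDiff_const.mul (contDiff_japaneseBracket.comp contDiff_fst)
      have hnum : ContDiffAt ℝ 1 (fun z : EuclideanSpace ℝ (Fin N) × ℝ => metricEnergy g z.1 y)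
          (x, t) := hex.comp (x, t) contDiffAt_fst
      have hpol : ContDiff ℝ 1 fun z : EuclideanSpace ℝ (Fin N) × ℝ =>
        k * (z.2 - s) ^ 2 := by fun_prop
      exact (((hnum.div hden.contDiffAt hc.ne').add hψ.contDiffAt).add
        (contDiff_const.mul contDiff_snd).contDiffAt).add hpol.contDiffAt
    · intro y' s' hs'
      have := hmax ((y', s'), (y, s)) ⟨⟨mem_univ _, hs'.1.le, hs'.2⟩, mem_univ _, hs.1.le, hs.2⟩
      simp only [doublingFunctional] at this
      linarith
    · have hden : HasDerivAt (fun r => c - ξ r - χ r) (-deriv ξ t - deriv χ t) t :=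
        (hξt.const_sub c).sub hχt
      have h2 := (((hasDerivAt_const t (metricEnergy g x y)).div hden hc.ne').add_const
        (δ * japaneseBracket x)).add ((hasDerivAt_id t).const_mul η)
      have h3 := (((hasDerivAt_id t).sub_const s).pow 2).const_mul k
      refine (h2.add h3).congr_deriv ?_
      simp only [id]
      rw [← hD]
      field_simp
      ring
    · have h2 := ((hpx.const_mul_real D⁻¹).fun_add_real
        ((hasGradientAt_japaneseBracket x).const_mul_real δ)).add_const_real
          (η * t + k * (t - s) ^ 2)
      convert h2 using 2
      rw [← hD]
      ring
  -- the inequality for `w`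
  have h2 : -(k * (2 * (t - s))) ≤ hamiltonian g (D⁻¹ • p') y * deriv χ s := by
    refine hw.le_of_forall_le hχ (φ := fun z => D⁻¹ * metricEnergy g z.1 x + k * (t - z.2) ^ 2)
      hs ?_ ?_ ?_ ?_
    · have hnum : ContDiffAt ℝ 1 (fun z : EuclideanSpace ℝ (Fin N) × ℝ => metricEnergy g z.1 x)
          (y, s) := hey.comp (y, s) contDiffAt_fst
      have hpol : ContDiff ℝ 1 fun z : EuclideanSpace ℝ (Fin N) × ℝ =>
        k * (t - z.2) ^ 2 := by fun_prop
      exact (contDiffAt_const.mul hnum).add hpol.contDiffAt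
    · intro y' s' hs'
      have := hmax ((x, t), (y', s')) ⟨⟨mem_univ _, ht.1.le, ht.2⟩, mem_univ _, hs'.1.le, hs'.2⟩
      simp only [doublingFunctional, ← hD, hcomm, div_eq_inv_mul] at this
      linarith
    · have h3 := ((((hasDerivAt_id s).const_sub t).pow 2).const_mul k).const_add
        (D⁻¹ * metricEnergy g y x)
      refine h3.congr_deriv ?_
      simp only [id]
      ring
    · exact (hpy.const_mul_real D⁻¹).add_const_real (k * (t - s) ^ 2)
  set q := (japaneseBracket x)⁻¹ • x
  have hq : hamiltonian g (δ • q) x ≤ δ ^ 2 * C := by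
    rw [IsC2Metric.hamiltonian_smul]
    gcongr
    refine (hC _ _).trans (mul_le_of_le_one_right hC0 ?_)
    exact pow_le_one₀ (norm_nonneg _) (norm_gradient_japaneseBracket_le _)
  have hpert : |hamiltonian g (D⁻¹ • p + δ • q) x - metricEnergy g x y / D ^ 2| ≤
      2 * (δ * √C * √Q) + δ ^ 2 * C := by
    rw [← hHp]
    refine (hg.abs_hamiltonian_add_sub_le _ _ _).trans ?_
    have h3 : √(hamiltonian g (δ • q) x) ≤ δ * √C := by
      refine (Real.sqrt_le_sqrt hq).trans_eq ?_
      rw [Real.sqrt_mul (sq_nonneg _), Real.sqrt_sq hδ]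
    have h4 : √(hamiltonian g (D⁻¹ • p) x) ≤ √Q := Real.sqrt_le_sqrt (by rwa [hHp])
    gcongr
  rw [hHp'] at h2
  have hE : 0 ≤ metricEnergy g x y / D ^ 2 := div_nonneg (metricEnergy_nonneg _ _) (sq_nonneg _)
  have h5 : (hamiltonian g (D⁻¹ • p + δ • q) x - metricEnergy g x y / D ^ 2) * deriv ξ t ≤
      (2 * (δ * √C * √Q) + δ ^ 2 * C) * L := by
    refine (le_abs_self _).trans ?_
    rw [abs_mul]
    gcongr
  have h6 : metricEnergy g x y / D ^ 2 * (deriv χ s - deriv χ t) ≤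
      Q * |deriv χ s - deriv χ t| := by
    refine (le_abs_self _).trans ?_
    rw [abs_mul, abs_of_nonneg hE]
    gcongr
  linarith

lemma upperSemicontinuousOn_doublingFunctional (hg : IsC2Metric g) (hξ : ContDiff ℝ 1 ξ)
    (hχ : ContDiff ℝ 1 χ) (hu : UpperSemicontinuousOn u (closedCylinder N T))
    (hw : UpperSemicontinuousOn w (closedCylinder N T)) {c : ℝ}
    (hc : ∀ t ∈ Icc 0 T, ξ t + χ t < c) (δ η : ℝ) :
    UpperSemicontinuousOn (doublingFunctional g ξ χ u w c δ η)
      (closedCylinder N T ×ˢ closedCylinder N T) := by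
  have h1 : ContinuousOn (fun z : (EuclideanSpace ℝ (Fin N) × ℝ) × (EuclideanSpace ℝ (Fin N) × ℝ) =>
      -(metricEnergy g z.1.1 z.2.1 / (c - ξ z.1.2 - χ z.1.2) +
        δ * japaneseBracket z.1.1 + η * z.1.2)) (closedCylinder N T ×ˢ closedCylinder N T) := by
    have hden : Continuous fun z : (EuclideanSpace ℝ (Fin N) × ℝ) ×
        (EuclideanSpace ℝ (Fin N) × ℝ) =>
        c - ξ z.1.2 - χ z.1.2 := by
      have := hξ.continuous
      have := hχ.continuous
      fun_prop
    have hnum : Continuous fun z : (EuclideanSpace ℝ (Fin N) × ℝ) ×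
        (EuclideanSpace ℝ (Fin N) × ℝ) =>
        metricEnergy g z.1.1 z.2.1 :=
      (continuous_metricEnergy hg).comp
        ((continuous_fst.comp continuous_fst).prodMk (continuous_fst.comp continuous_snd))
    have hψ : Continuous fun z : (EuclideanSpace ℝ (Fin N) × ℝ) × (EuclideanSpace ℝ (Fin N) × ℝ) =>
        δ * japaneseBracket z.1.1 :=
      continuous_const.mul
        (contDiff_japaneseBracket.continuous.comp (continuous_fst.comp continuous_fst))
    refine (((hnum.continuousOn.div hden.continuousOn fun z hz => ?_).add hψ.continuousOn).add
      (by fun_prop)).neg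
    have := hc z.1.2 hz.1.2
    exact ne_of_gt (by linarith)
  have h2 := ((hu.comp continuousOn_fst fun z hz => hz.1).add
    (hw.comp continuousOn_snd fun z hz => hz.2)).add h1.upperSemicontinuousOn
  have h3 : doublingFunctional g ξ χ u w c δ η = fun z => (u ∘ Prod.fst) z + (w ∘ Prod.snd) z +
      -(metricEnergy g z.1.1 z.2.1 / (c - ξ z.1.2 - χ z.1.2) +
        δ * japaneseBracket z.1.1 + η * z.1.2) := by
    funext z
    simp only [doublingFunctional, Function.comp_apply]
    ring
  rw [h3]
  exact h2

/-- If `u₀(x) + w₀(y) - e(x, y) / c ≤ B` for all `x`, `y`, then `u + w ≤ B` as long as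
`c - ξ - χ` is positive and the points that matter stay where `e` is `C¹`. -/
lemma add_le_of_doubling (hg : IsC2Metric g) {Υ : ℝ} (hΥ : 0 < Υ)
    (hinj : ContDiffOn ℝ 1
      (fun p : EuclideanSpace ℝ (Fin N) × EuclideanSpace ℝ (Fin N) => metricEnergy g p.1 p.2)
      {p | metricDist g p.1 p.2 < Υ})
    (hT : 0 < T) (hξ : ContDiff ℝ 1 ξ) (hχ : ContDiff ℝ 1 χ) (hξ0 : ξ 0 = 0) (hχ0 : χ 0 = 0)
    (hu : IsViscositySubsolution g T ξ u₀ u) (hw : IsViscositySubsolution g T χ w₀ w)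
    {a b c B : ℝ} (ha : ∀ x, u₀ x ≤ a) (hb : ∀ x, w₀ x ≤ b)
    (hc : ∀ t ∈ Icc 0 T, ξ t + χ t < c)
    (hcΥ : ∀ t ∈ Icc 0 T, (a + b - B) * (c - ξ t - χ t) ≤ Υ ^ 2)
    (hB : ∀ x y, u₀ x + w₀ y - metricEnergy g x y / c ≤ B) :
    ∀ z ∈ closedCylinder N T, u z + w z ≤ B := by
  intro z₀ hz₀
  by_contra! hlt
  have hua := hu.le_of_initial_le hg hT hξ ha
  have hwb := hw.le_of_initial_le hg hT hχ hb
  set G := a + b - B with hG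
  have hG0 : 0 < G := by linarith [hua z₀ hz₀, hwb z₀ hz₀]
  obtain ⟨L, hL0, hL⟩ := exists_abs_deriv_le hξ T
  obtain ⟨C, hC0, hC⟩ := hg.exists_hamiltonian_le
  obtain ⟨m, hm0, hm⟩ := exists_norm_le_metricDist hg
  obtain ⟨D₀, hD₀, hD⟩ : ∃ D₀ > 0, ∀ t ∈ Icc 0 T, D₀ ≤ c - ξ t - χ t := by
    obtain ⟨t, ht, hmin⟩ := isCompact_Icc.exists_isMinOn (nonempty_Icc.2 hT.le)
      (((continuous_const.sub hξ.continuous).sub hχ.continuous).continuousOn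
        (f := fun t => c - ξ t - χ t) (s := Icc 0 T))
    exact ⟨_, by linarith [hc t ht], fun s hs => hmin hs⟩
  set Q := G / D₀ with hQ
  have hQ0 : 0 < Q := div_pos hG0 hD₀
  -- the penalization parameters
  set η := (u z₀ + w z₀ - B) / (2 * T) with hη
  have hη0 : 0 < η := div_pos (by linarith) (by linarith)
  have hηT : η * T = (u z₀ + w z₀ - B) / 2 := by rw [hη]; field_simp
  obtain ⟨δ, ⟨hδ1, hδ2⟩, hδ0⟩ : ∃ δ : ℝ, (δ * japaneseBracket z₀.1 < (u z₀ + w z₀ - B) / 2 ∧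
      (2 * (δ * √C * √Q) + δ ^ 2 * C) * L < η / 2) ∧ 0 < δ := by
    have h1 : Tendsto (fun δ : ℝ => δ * japaneseBracket z₀.1) (𝓝 0)
        (𝓝 (0 * japaneseBracket z₀.1)) := Continuous.tendsto (by fun_prop) 0
    have h2 : Tendsto (fun δ : ℝ => (2 * (δ * √C * √Q) + δ ^ 2 * C) * L) (𝓝 0)
        (𝓝 ((2 * (0 * √C * √Q) + 0 ^ 2 * C) * L)) := Continuous.tendsto (by fun_prop) 0
    rw [zero_mul] at h1
    norm_num at h2
    have h3 := (h1.eventually (gt_mem_nhds (half_pos (sub_pos.2 hlt)))).and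
      (h2.eventually (gt_mem_nhds (half_pos hη0)))
    exact ((h3.filter_mono nhdsWithin_le_nhds).and
      (self_mem_nhdsWithin : ∀ᶠ δ : ℝ in 𝓝[>] 0, δ ∈ Ioi (0 : ℝ))).exists
  obtain ⟨τ₁, hτ₁, hunif⟩ := Metric.uniformContinuousOn_iff.1
    (isCompact_Icc.uniformContinuousOn_of_continuous
      (hχ.continuous_deriv le_rfl).continuousOn (s := Icc 0 T)) (η / 2 / Q) (by positivity)
  set P := doublingFunctional g ξ χ u w c δ η with hP
  set cyl := closedCylinder N T ×ˢ closedCylinder N T with hcyl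
  have husc : UpperSemicontinuousOn P cyl :=
    upperSemicontinuousOn_doublingFunctional hg hξ hχ hu.usc hw.usc hc δ η
  -- consequences of `B ≤ P`
  have hsuper : ∀ z ∈ cyl, B ≤ P z →
      metricEnergy g z.1.1 z.2.1 / (c - ξ z.1.2 - χ z.1.2) + δ * japaneseBracket z.1.1 ≤ G := by
    intro z hz hBz
    have h1 := hua _ hz.1
    have h2 := hwb _ hz.2
    have h3 := mul_nonneg hη0.le hz.1.2.1
    simp only [hP, doublingFunctional] at hBz
    linarith
  have hen : ∀ z ∈ cyl, 0 ≤ metricEnergy g z.1.1 z.2.1 / (c - ξ z.1.2 - χ z.1.2) := fun z hz =>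
    div_nonneg (metricEnergy_nonneg _ _) (hD₀.le.trans (hD _ hz.1.2))
  have hdist : ∀ z ∈ cyl, B ≤ P z → metricDist g z.1.1 z.2.1 < Υ := by
    intro z hz hBz
    have h1 := hsuper z hz hBz
    have h2 : 0 < δ * japaneseBracket z.1.1 :=
      mul_pos hδ0 (zero_lt_one.trans_le (one_le_japaneseBracket _))
    have h3 : metricEnergy g z.1.1 z.2.1 / (c - ξ z.1.2 - χ z.1.2) < G := by linarith
    rw [div_lt_iff₀ (hD₀.trans_le (hD _ hz.1.2))] at h3
    exact lt_of_pow_lt_pow_left₀ 2 hΥ.le (h3.trans_le (hcΥ _ hz.1.2))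
  set R := G / δ + Υ / m with hR
  set K : Set ((EuclideanSpace ℝ (Fin N) × ℝ) × (EuclideanSpace ℝ (Fin N) × ℝ)) :=
    (Metric.closedBall 0 R ×ˢ Icc 0 T) ×ˢ (Metric.closedBall 0 R ×ˢ Icc 0 T) with hK
  have hKc : IsCompact K := ((isCompact_closedBall _ _).prod isCompact_Icc).prod
    ((isCompact_closedBall _ _).prod isCompact_Icc)
  have hKcyl : K ⊆ cyl := fun z hz => ⟨⟨mem_univ _, hz.1.2⟩, mem_univ _, hz.2.2⟩
  have hmemK : ∀ z ∈ cyl, B ≤ P z → z ∈ K := by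
    intro z hz hBz
    have h1 := hsuper z hz hBz
    have h2 := hen z hz
    have h3 := mul_le_mul_of_nonneg_left (norm_le_japaneseBracket z.1.1) hδ0.le
    have h4 : ‖z.1.1‖ ≤ G / δ := by rw [le_div_iff₀ hδ0]; linarith
    have h5 : ‖z.1.1 - z.2.1‖ ≤ Υ / m := by
      rw [le_div_iff₀ hm0]
      linarith [hm z.1.1 z.2.1, hdist z hz hBz]
    have h6 : 0 ≤ Υ / m := by positivity
    refine ⟨⟨?_, hz.1.2⟩, ?_, hz.2.2⟩
    · rw [mem_closedBall_zero_iff]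
      linarith
    · rw [mem_closedBall_zero_iff]
      have := norm_sub_norm_le z.2.1 z.1.1
      rw [norm_sub_rev] at this
      linarith
  have hz₀cyl : (z₀, z₀) ∈ cyl := ⟨hz₀, hz₀⟩
  have hPz₀ : B < P (z₀, z₀) := by
    have h3 := mul_le_mul_of_nonneg_left hz₀.2.2 hη0.le
    simp only [hP, doublingFunctional, metricEnergy, metricDist_self hg]
    norm_num
    linarith
  -- by the condition on the initial data, the superlevel set stays away from `t = s = 0`
  obtain ⟨τ₀, hτ₀, hsum⟩ : ∃ τ₀ > 0, ∀ z ∈ cyl, B ≤ P z → τ₀ ≤ z.1.2 + z.2.2 := by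
    have hcomp := (husc.mono hKcyl).isCompact_inter_preimage_Ici hKc B
    obtain ⟨z, hz, hmin⟩ := hcomp.exists_isMinOn ⟨_, hmemK _ hz₀cyl hPz₀.le, hPz₀.le⟩
      ((by fun_prop : Continuous fun z : (EuclideanSpace ℝ (Fin N) × ℝ) ×
        (EuclideanSpace ℝ (Fin N) × ℝ) => z.1.2 + z.2.2).continuousOn)
    refine ⟨z.1.2 + z.2.2, ?_, fun y hy hBy => hmin ⟨hmemK y hy hBy, hBy⟩⟩
    have h1 := hz.1.1.2.1
    have h2 := hz.1.2.2.1
    refine (add_nonneg h1 h2).lt_of_ne fun h0 => ?_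
    obtain ⟨⟨x, t⟩, ⟨y, s⟩⟩ := z
    dsimp only at h0 h1 h2
    obtain rfl : t = 0 := by linarith
    obtain rfl : s = 0 := by linarith
    have h3 : B ≤ P ((x, 0), (y, 0)) := hz.2
    simp only [hP, doublingFunctional, hξ0, hχ0, sub_zero, mul_zero] at h3
    have h4 : 0 < δ * japaneseBracket x :=
      mul_pos hδ0 (zero_lt_one.trans_le (one_le_japaneseBracket _))
    linarith [hB x y, hu.initial x, hw.initial y]
  -- `k` is chosen so that maximum points satisfy `|t - s| < μ`: then `t + s ≥ τ₀` forces both times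
  -- to be positive, and `χ'` hardly changes between them
  set μ := min τ₀ τ₁ with hμ
  have hμ0 : 0 < μ := lt_min hτ₀ hτ₁
  set k := G / μ ^ 2 with hk
  have hk0 : 0 < k := by positivity
  have hPle : ∀ z : (EuclideanSpace ℝ (Fin N) × ℝ) × (EuclideanSpace ℝ (Fin N) × ℝ),
      P z - k * (z.1.2 - z.2.2) ^ 2 ≤ P z := fun z =>
    sub_le_self _ (mul_nonneg hk0.le (sq_nonneg _))
  obtain ⟨⟨⟨x, t⟩, ⟨y, s⟩⟩, hz, hBz, hmax⟩ := exists_forall_le_of_superlevel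
    (f := fun z => P z - k * (z.1.2 - z.2.2) ^ 2) (B := B) hKc hKcyl (by
      simp only [sub_eq_add_neg]
      have hk : Continuous fun z : (EuclideanSpace ℝ (Fin N) × ℝ) ×
          (EuclideanSpace ℝ (Fin N) × ℝ) => -(k * (z.1.2 + -z.2.2) ^ 2) := by fun_prop
      exact (husc.mono hKcyl).add hk.continuousOn.upperSemicontinuousOn)
    (fun z hz hBz => hmemK z hz (hBz.le.trans (hPle z))) hz₀cyl (by simpa using hPz₀)
  have hBP : B ≤ P ((x, t), (y, s)) := hBz.le.trans (hPle _)
  have htT : t ∈ Icc 0 T := hz.1.2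
  have hsT : s ∈ Icc 0 T := hz.2.2
  have hsup := hsuper _ hz hBP
  have hDt := hD t htT
  have hDt0 : 0 < c - ξ t - χ t := hD₀.trans_le hDt
  have hJ : 0 < δ * japaneseBracket x :=
    mul_pos hδ0 (zero_lt_one.trans_le (one_le_japaneseBracket _))
  have hts : |t - s| < μ := by
    have h1 : k * (t - s) ^ 2 < k * μ ^ 2 := by
      have h2 : k * μ ^ 2 = G := by rw [hk]; field_simp
      have h3 := hua _ hz.1
      have h4 := hwb _ hz.2
      have h5 := mul_nonneg hη0.le htT.1
      have h6 := hen _ hz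
      simp only [hP, doublingFunctional] at hBz
      dsimp only at h3 h4 h6
      linarith
    exact abs_lt_of_sq_lt_sq (lt_of_mul_lt_mul_left h1 hk0.le) hμ0.le
  have hsum' : τ₀ ≤ t + s := hsum _ hz hBP
  have hts' := abs_lt.1 (hts.trans_le (min_le_left τ₀ τ₁))
  have hlt : metricDist g x y < Υ := hdist _ hz hBP
  have hopen := isOpen_metricDist_lt hg Υ
  have hQe : metricEnergy g x y / (c - ξ t - χ t) ^ 2 ≤ Q := by
    have h1 : metricEnergy g x y / (c - ξ t - χ t) ≤ G := by
      dsimp only at hsup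
      linarith
    rw [sq, ← div_div]
    exact div_le_div₀ hG0.le h1 hD₀ hDt
  have hfinal := le_of_doubling_max hg hξ hχ hu hw (x := x) (y := y) (t := t) (s := s)
    ⟨by linarith, htT.2⟩ ⟨by linarith, hsT.2⟩ hδ0.le hC0.le (hL t htT) hC hDt0 hQe
    (hinj.contDiffAt (hopen.mem_nhds hlt))
    (hinj.contDiffAt (hopen.mem_nhds (by
      change metricDist g y x < Υ
      rwa [metricDist_comm]))) hmax
  have hχs : |deriv χ s - deriv χ t| < η / 2 / Q := by
    rw [← Real.dist_eq]
    refine hunif s hsT t htT ?_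
    rw [dist_comm, Real.dist_eq]
    exact hts.trans_le (min_le_right _ _)
  rw [lt_div_iff₀ hQ0] at hχs
  linarith

end Doubling

/-! ### The comparison estimate -/

section Comparison

variable {N : ℕ} {g : EuclideanSpace ℝ (Fin N) → Matrix (Fin N) (Fin N) ℝ} {T : ℝ}
  {ξ ζ : ℝ → ℝ} {u₀ v₀ : EuclideanSpace ℝ (Fin N) → ℝ} {u v : EuclideanSpace ℝ (Fin N) × ℝ → ℝ}

lemma abs_le_supNorm {f : EuclideanSpace ℝ (Fin N) → ℝ} (hf : ∃ C : ℝ, ∀ x, |f x| ≤ C)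
    (x : EuclideanSpace ℝ (Fin N)) : |f x| ≤ supNorm f := by
  obtain ⟨C, hC⟩ := hf
  exact le_ciSup (f := fun x => |f x|) ⟨C, by rintro _ ⟨y, rfl⟩; exact hC y⟩ x

lemma sub_le_pathGap (hξ : ContinuousOn ξ (Icc 0 T)) (hζ : ContinuousOn ζ (Icc 0 T)) {t : ℝ}
    (ht : t ∈ Icc 0 T) : ξ t - ζ t ≤ pathGap T ξ ζ :=
  le_csSup (isCompact_Icc.image_of_continuousOn (hξ.sub hζ)).bddAbove ⟨t, ht, rfl⟩

/-- The comparison of `u` and `v` with the doubling constant `c` and the bound `B` still free. -/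
lemma sub_le_of_forall_sub_energy_le (hg : IsC2Metric g) {Υ : ℝ} (hΥ : 0 < Υ)
    (hinj : ContDiffOn ℝ 1
      (fun p : EuclideanSpace ℝ (Fin N) × EuclideanSpace ℝ (Fin N) => metricEnergy g p.1 p.2)
      {p | metricDist g p.1 p.2 < Υ})
    (hT : 0 < T) (hξ : ContDiffOn ℝ 1 ξ (Icc 0 T)) (hξ0 : ξ 0 = 0)
    (hζ : ContDiffOn ℝ 1 ζ (Icc 0 T)) (hζ0 : ζ 0 = 0)
    (hu₀ : ∃ C : ℝ, ∀ x, |u₀ x| ≤ C) (hv₀ : ∃ C : ℝ, ∀ x, |v₀ x| ≤ C)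
    (hu : IsViscositySubsolution g T ξ u₀ u) (hv : IsViscositySupersolution g T ζ v₀ v)
    {c B : ℝ} (hc : pathGap T ξ ζ < c)
    (hcΥ : (c + pathGap T ζ ξ) * (2 * (supNorm u₀ + supNorm v₀)) < Υ ^ 2)
    (hB : ∀ x y, u₀ x - v₀ y - metricEnergy g x y / c ≤ B) :
    ∀ z ∈ closedCylinder N T, u z - v z ≤ B := by
  obtain ⟨ξ', hξ', hξeq⟩ := hξ.exists_contDiff_eqOn hT
  obtain ⟨ζ', hζ', hζeq⟩ := hζ.exists_contDiff_eqOn hT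
  have h0 : (0 : ℝ) ∈ Icc 0 T := ⟨le_rfl, hT.le⟩
  have hBu : -(supNorm u₀ + supNorm v₀) ≤ B := by
    have h1 := hB 0 0
    rw [metricEnergy, metricDist_self hg] at h1
    have h2 := (abs_le.1 (abs_le_supNorm hu₀ 0)).1
    have h3 := (abs_le.1 (abs_le_supNorm hv₀ 0)).2
    norm_num at h1
    linarith
  have hab : 0 ≤ supNorm u₀ + supNorm v₀ := add_nonneg
    ((abs_nonneg _).trans (abs_le_supNorm hu₀ 0)) ((abs_nonneg _).trans (abs_le_supNorm hv₀ 0))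
  have hgap : ∀ t ∈ Icc 0 T, ξ t - ζ t < c := fun t ht =>
    (sub_le_pathGap hξ.continuousOn hζ.continuousOn ht).trans_lt hc
  have h := add_le_of_doubling (B := B) (c := c) hg hΥ hinj hT hξ' hζ'.neg
    (by rw [hξeq h0, hξ0]) (by rw [hζeq h0, hζ0, neg_zero]) (hu.congr_path hξeq)
    (hv.neg.congr_path fun t ht => congrArg Neg.neg (hζeq ht))
    (fun x => (abs_le.1 (abs_le_supNorm hu₀ x)).2)
    (fun x => neg_le.1 (abs_le.1 (abs_le_supNorm hv₀ x)).1)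
    (fun t ht => by
      rw [hξeq ht, hζeq ht, ← sub_eq_add_neg]
      exact hgap t ht)
    (fun t ht => by
      rw [hξeq ht, hζeq ht, sub_neg_eq_add]
      have h1 := hgap t ht
      have h2 := sub_le_pathGap hζ.continuousOn hξ.continuousOn ht
      calc (supNorm u₀ + supNorm v₀ - B) * (c - ξ t + ζ t)
          ≤ (2 * (supNorm u₀ + supNorm v₀)) * (c + pathGap T ζ ξ) :=
            mul_le_mul (by linarith) (by linarith) (by linarith) (by linarith)
        _ ≤ Υ ^ 2 := by rw [mul_comm]; exact hcΥ.le)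
    (fun x y => by simpa only [← sub_eq_add_neg] using hB x y)
  intro z hz
  rw [sub_eq_add_neg]
  exact h z hz

/-- Real consequences of an upper bound for the right-hand side of the estimate. -/
lemma add_le_of_iSup_add_theta_le {ω : ℝ → ℝ} {lam : ℝ≥0∞} {B : ℝ}
    (h : (⨆ x, ((u₀ x - v₀ x : ℝ) : EReal)) + theta ω lam ≤ (B : EReal))
    {l r : ℝ} (hr : 0 ≤ r) (hl : lam * ENNReal.ofReal (r ^ 2 / 2) = ENNReal.ofReal l) (hl0 : 0 ≤ l)
    (x : EuclideanSpace ℝ (Fin N)) : u₀ x - v₀ x + (ω r - l) ≤ B := by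
  have h1 : ((u₀ x - v₀ x : ℝ) : EReal) ≤ ⨆ x, ((u₀ x - v₀ x : ℝ) : EReal) :=
    le_iSup (fun x => ((u₀ x - v₀ x : ℝ) : EReal)) x
  have h2 : ((ω r - l : ℝ) : EReal) ≤ theta ω lam := by
    refine le_trans (le_of_eq ?_) (le_iSup₂ (f := fun r (_ : r ∈ Ici (0 : ℝ)) =>
      ((ω r : ℝ) : EReal) - ((lam * ENNReal.ofReal (r ^ 2 / 2) : ℝ≥0∞) : EReal)) r hr)
    rw [hl, EReal.coe_ennreal_ofReal, max_eq_left hl0, EReal.coe_sub]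
  have h3 := (add_le_add h1 h2).trans h
  exact_mod_cast h3

end Comparison

end

theorem theorem1 (N : ℕ)
    (g : EuclideanSpace ℝ (Fin N) → Matrix (Fin N) (Fin N) ℝ) (hg : IsC2Metric g)
    (Υ : ℝ) (hΥ : 0 < Υ)
    (hinj : ContDiffOn ℝ 1
      (fun p : EuclideanSpace ℝ (Fin N) × EuclideanSpace ℝ (Fin N) => metricEnergy g p.1 p.2)
      {p | metricDist g p.1 p.2 < Υ})
    (T : ℝ) (hT : 0 < T) (ξ ζ : ℝ → ℝ)
    (hξ : ContDiffOn ℝ 1 ξ (Icc 0 T)) (hξ0 : ξ 0 = 0)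
    (hζ : ContDiffOn ℝ 1 ζ (Icc 0 T)) (hζ0 : ζ 0 = 0)
    (u₀ v₀ : EuclideanSpace ℝ (Fin N) → ℝ)
    (hu₀ : ∃ C : ℝ, ∀ x, |u₀ x| ≤ C) (hv₀ : ∃ C : ℝ, ∀ x, |v₀ x| ≤ C)
    (ωu ωv : ℝ → ℝ) (hωu : HasModulus g u₀ ωu) (hωv : HasModulus g v₀ ωv)
    (u v : EuclideanSpace ℝ (Fin N) × ℝ → ℝ)
    (hu : IsViscositySubsolution g T ξ u₀ u)
    (hv : IsViscositySupersolution g T ζ v₀ v)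
    (hΔ : ENNReal.ofReal (pathGap T ξ ζ + pathGap T ζ ξ) <
      ENNReal.ofReal (Υ ^ 2) / ENNReal.ofReal (2 * (supNorm u₀ + supNorm v₀))) :
    (⨆ z ∈ closedCylinder N T, ((u z - v z : ℝ) : EReal)) ≤
      (⨆ x, ((u₀ x - v₀ x : ℝ) : EReal)) +
        theta (fun r => min (ωu r) (ωv r)) (ENNReal.ofReal (pathGap T ξ ζ))⁻¹ := by
  set Δ := pathGap T ξ ζ with hΔdef
  set Δ' := pathGap T ζ ξ with hΔ'def
  set S := supNorm u₀ + supNorm v₀ with hS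
  have h0 : (0 : ℝ) ∈ Icc 0 T := ⟨le_rfl, hT.le⟩
  have hΔ0 : 0 ≤ Δ := by
    simpa [hξ0, hζ0] using sub_le_pathGap hξ.continuousOn hζ.continuousOn h0
  have hΔ'0 : 0 ≤ Δ' := by
    simpa [hξ0, hζ0] using sub_le_pathGap hζ.continuousOn hξ.continuousOn h0
  have hS0 : 0 ≤ S := add_nonneg ((abs_nonneg _).trans (abs_le_supNorm hu₀ 0))
    ((abs_nonneg _).trans (abs_le_supNorm hv₀ 0))
  have hreal : (Δ + Δ') * (2 * S) < Υ ^ 2 := by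
    rcases hS0.eq_or_lt with h | h
    · rw [← h]; simpa using pow_pos hΥ 2
    · rw [ENNReal.lt_div_iff_mul_lt (Or.inl (by simpa using h)) (Or.inl ENNReal.ofReal_ne_top),
        ← ENNReal.ofReal_mul (add_nonneg hΔ0 hΔ'0)] at hΔ
      exact (ENNReal.ofReal_lt_ofReal_iff (by positivity)).1 hΔ
  have hcΥ : ∀ᶠ c : ℝ in 𝓝[>] Δ, (c + Δ') * (2 * S) < Υ ^ 2 :=
    ((by fun_prop : Continuous fun c : ℝ => (c + Δ') * (2 * S)).continuousAt.eventually
      (gt_mem_nhds hreal)).filter_mono nhdsWithin_le_nhds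
  refine iSup₂_le fun z hz => EReal.le_of_forall_lt_iff_le.1 fun B hB => ?_
  obtain ⟨B', hB', hB'B⟩ := EReal.lt_iff_exists_real_btwn.1 hB
  have hB'B : B' < B := by exact_mod_cast hB'B
  rw [EReal.coe_le_coe_iff]
  rcases hΔ0.eq_or_lt with hΔz | hΔpos
  · -- `1 / Δ = ∞`: the constant `c` is taken so small that `e / c` absorbs the oscillation of `u₀`
    have hdiag : ∀ x, u₀ x - v₀ x ≤ B' := fun x => by
      have := add_le_of_iSup_add_theta_le hB'.le (l := 0) le_rfl (by simp) le_rfl x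
      simpa [hωu.1.map_zero, hωv.1.map_zero] using this
    have hω := hωu.1.tendsto_zero.eventually (gt_mem_nhds (sub_pos.2 hB'B))
    obtain ⟨r₀, hr₀, hωr⟩ := Metric.mem_nhdsWithin_iff.1 hω
    have hsmall : ∀ᶠ c : ℝ in 𝓝[>] Δ, c * (S - B) < r₀ ^ 2 := by
      refine ((by fun_prop : Continuous fun c : ℝ => c * (S - B)).continuousAt.eventually
        (gt_mem_nhds ?_)).filter_mono nhdsWithin_le_nhds
      simpa only [← hΔz, zero_mul] using pow_pos hr₀ 2
    obtain ⟨c, ⟨hc1, hc2⟩, hc3⟩ := ((hcΥ.and hsmall).and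
      (self_mem_nhdsWithin : ∀ᶠ c : ℝ in 𝓝[>] Δ, c ∈ Ioi Δ)).exists
    have hc0 : 0 < c := hΔ0.trans_lt hc3
    refine sub_le_of_forall_sub_energy_le hg hΥ hinj hT hξ hξ0 hζ hζ0 hu₀ hv₀ hu hv hc3 hc1
      (fun x y => ?_) z hz
    rcases lt_or_ge (metricDist g x y) r₀ with hd | hd
    · have h1 : ωu (metricDist g x y) < B - B' := hωr
        ⟨by rwa [Metric.mem_ball, Real.dist_0_eq_abs, abs_of_nonneg (metricDist_nonneg x y)],
          metricDist_nonneg x y⟩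
      have h2 := (abs_le.1 (hωu.2 x y)).2
      have h3 : 0 ≤ metricEnergy g x y / c := div_nonneg (metricEnergy_nonneg _ _) hc0.le
      linarith [hdiag y]
    · have h1 : S - B ≤ metricEnergy g x y / c := by
        rw [le_div_iff₀ hc0, metricEnergy]
        have := pow_le_pow_left₀ hr₀.le hd 2
        linarith
      have h2 := (abs_le.1 (abs_le_supNorm hu₀ x)).2
      have h3 := (abs_le.1 (abs_le_supNorm hv₀ y)).1
      linarith
  · -- any `c` in `(Δ, 2 Δ]` close to `Δ` will do, since `e / c ≥ d² / (2 Δ)`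
    obtain ⟨c, ⟨hc1, hc2⟩, hc3⟩ := ((hcΥ.and ((eventually_lt_nhds
      (by linarith : Δ < 2 * Δ)).filter_mono nhdsWithin_le_nhds)).and
      (self_mem_nhdsWithin : ∀ᶠ c : ℝ in 𝓝[>] Δ, c ∈ Ioi Δ)).exists
    have hc0 : 0 < c := hΔ0.trans_lt hc3
    refine sub_le_of_forall_sub_energy_le hg hΥ hinj hT hξ hξ0 hζ hζ0 hu₀ hv₀ hu hv hc3 hc1
      (fun x y => ?_) z hz
    have hθ := add_le_of_iSup_add_theta_le hB'.le (l := Δ⁻¹ * (metricDist g x y ^ 2 / 2))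
      (metricDist_nonneg x y)
      (by rw [← ENNReal.ofReal_inv_of_pos hΔpos, ENNReal.ofReal_mul (by positivity)])
      (by positivity)
    have he : Δ⁻¹ * (metricDist g x y ^ 2 / 2) ≤ metricEnergy g x y / c :=
      calc Δ⁻¹ * (metricDist g x y ^ 2 / 2) = metricDist g x y ^ 2 / (2 * Δ) := by field_simp
        _ ≤ _ := by rw [metricEnergy]; gcongr
    have hωu' := (abs_le.1 (hωu.2 x y)).2
    have hωv' := (abs_le.1 (hωv.2 x y)).2
    rcases min_cases (ωu (metricDist g x y)) (ωv (metricDist g x y)) with ⟨h, -⟩ | ⟨h, -⟩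
    · have := hθ y
      rw [h] at this
      linarith
    · have := hθ x
      rw [h] at this
      linarith
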